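/- Let $k \ge 3$ and let $F_k$ be the free group on $k$ generators $x_1,\dots,x_k$. The length of an element of $F_k$ is the length of the reduced word in $x_1^{\pm1},\dots,x_k^{\pm1}$ representing it. An element is primitive if it belongs to some free generating set of $F_k$, and a subgroup $H \le F_k$ is a free factor if $F_k = H * K$ for some subgroup $K \le F_k$; it is a proper free factor if moreover $H \ne F_k$. For $N \ge 0$ let $P_{k,N}$ be the set of primitive elements of length $N$ in $F_k$, and let $S_{k,N}$ be the set of elements of length $N$ in $F_k$ that are contained in some proper free factor of $F_k$. Then \[ \lim_{N\to\infty}\sqrt[N]{|S_{k,N}|}=\lim_{N\to\infty}\sqrt[N]{|S_{k,N}\setminus P_{k,N}|}=2k-3 , \] where both limits exist. -/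

import Mathlib

universe u

/-- An element of a group `G` is primitive if it belongs to some free generating set of `G`. -/
def IsPrimitive {G : Type u} [Group G] (w : G) : Prop :=
  ∃ (ι : Type u) (b : FreeGroupBasis ι G), w ∈ Set.range b

/-- A subgroup `H` of `G` is a free factor if there is a subgroup `K` of `G` such that `G` is the
internal free product `H * K`: the canonical homomorphism from the free product of `H` and `K`
to `G` is bijective. -/
def IsFreeFactor {G : Type u} [Group G] (H : Subgroup G) : Prop :=
  ∃ K : Subgroup G, Function.Bijective (Monoid.Coprod.lift H.subtype K.subtype)

/-- The set of primitive elements of reduced word length `N` in the free group on `k` letters. -/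
def primitiveWords (k N : ℕ) : Set (FreeGroup (Fin k)) :=
  {w | w.norm = N ∧ IsPrimitive w}

/-- The set of elements of reduced word length `N` in the free group on `k` letters that are
contained in some proper free factor. -/
def properFreeFactorWords (k N : ℕ) : Set (FreeGroup (Fin k)) :=
  {w | w.norm = N ∧ ∃ H : Subgroup (FreeGroup (Fin k)), IsFreeFactor H ∧ H ≠ ⊤ ∧ w ∈ H}

/-- These sets are finite, so that `Set.ncard` is their true cardinality. -/
theorem properFreeFactorWords_finite (k N : ℕ) : (properFreeFactorWords k N).Finite := by
  refine Set.Finite.subset (Set.Finite.preimage (f := FreeGroup.toWord)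
    FreeGroup.toWord_injective.injOn (List.finite_length_eq (Fin k × Bool) N)) ?_
  rintro w ⟨hw, -⟩
  exact hw

/-! Lower bound: the free factor on the first `k - 1` generators has at least `(2k-3)^M` reduced
words of length `M`. A tail of `6(k-1)` further letters makes all exponent sums vanish mod 3
(`exists_tail_wordEval_eq_zero`). The result is not primitive, since a basis element takes the value
1 under some character to `ZMod 3`. This gives `pow_le_ncard_sdiff`.

Upper bound: conjugating words cost nothing exponentially, because `2k ≤ (2k-3)^2`, so cyclically
reduced words suffice. Such a word `w` in a proper free factor lies in a subgroup generated by all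
but one of `k` generators of the free group. Call `|E| - |V| + 1` the rank of a connected graph.
Stallings folding reads `w` as a closed path in a graph of rank at most `k - 1`. Fix `D`. If the
path traces at most `D` edges, each step has at most `2(k-1) - 1 = 2k - 3` reduced continuations,
because a leafless connected graph of rank `s` has degrees at most `2s`. Otherwise a loop for the
missing generator is attached and the graph is folded onto a rose, one fold at a time. The rank
stays `k`, each fold loses exactly one edge, and so at some stage the trace has exactly `D` edges
(`exists_closed_path`).

In that trace some edge is traversed at most `N / D` times. At a suitable scale, a bounded multiple
of `N / D`, the edges traversed more often form a proper leafless subgraph, whose degrees are at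
most `2(k-1)`. Only `O(N / D)` steps at branch points involve other edges
(`IsReducedTour.exists_relation`). Weighting these exceptional steps in a transfer matrix
(`ncard_walkWords_mul_pow_le`) gives `O((2k-3+ε)^N)` words once `D` is large. -/

set_option linter.unusedSectionVars false

/-! ### Stallings folding and ranks of labelled graphs. -/

section Folding

variable {α : Type*} [DecidableEq α]

/-- The positively oriented labelled edge traversed when reading the letter `l` from `u` to `v`. -/
def orientedEdge (u : ℕ) (l : α × Bool) (v : ℕ) : ℕ × α × ℕ :=
  if l.2 then (u, l.1, v) else (v, l.1, u)

/-- `IsPathIn G u L v`: the word `L` labels a path from `u` to `v` in the labelled graph `G`. -/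
def IsPathIn (G : Finset (ℕ × α × ℕ)) : ℕ → List (α × Bool) → ℕ → Prop
  | u, [], v => u = v
  | u, l :: L, v => ∃ x, orientedEdge u l x ∈ G ∧ IsPathIn G x L v

theorem orientedEdge_inv (u v : ℕ) (l : α × Bool) :
    orientedEdge u (l.1, !l.2) v = orientedEdge v l u := by
  rcases l with ⟨s, _ | _⟩ <;> simp [orientedEdge]

theorem isPathIn_append {G : Finset (ℕ × α × ℕ)} {u v : ℕ} {L₁ L₂ : List (α × Bool)} :
    IsPathIn G u (L₁ ++ L₂) v ↔ ∃ x, IsPathIn G u L₁ x ∧ IsPathIn G x L₂ v := by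
  induction L₁ generalizing u with
  | nil => simp [IsPathIn]
  | cons l L ih =>
    simp only [List.cons_append, IsPathIn, ih]
    constructor
    · rintro ⟨x, hx, y, hy, hv⟩
      exact ⟨y, ⟨x, hx, hy⟩, hv⟩
    · rintro ⟨y, ⟨x, hx, hy⟩, hv⟩
      exact ⟨x, hx, y, hy, hv⟩

theorem IsPathIn.invRev {G : Finset (ℕ × α × ℕ)} {u v : ℕ} {L : List (α × Bool)}
    (h : IsPathIn G u L v) : IsPathIn G v (FreeGroup.invRev L) u := by
  induction L generalizing u with
  | nil => simpa [IsPathIn, FreeGroup.invRev] using h.symm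
  | cons l L ih =>
    obtain ⟨x, hx, hL⟩ := h
    rw [FreeGroup.invRev_cons, isPathIn_append]
    refine ⟨x, ih hL, u, ?_, rfl⟩
    simpa [orientedEdge_inv] using hx

theorem IsPathIn.mono {G G' : Finset (ℕ × α × ℕ)} (hG : G ⊆ G') {u v : ℕ} {L : List (α × Bool)}
    (h : IsPathIn G u L v) : IsPathIn G' u L v := by
  induction L generalizing u with
  | nil => exact h
  | cons l L ih =>
    obtain ⟨x, hx, hL⟩ := h
    exact ⟨x, hG hx, ih hL⟩

/-- The action of a map of vertices on labelled edges. -/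
def mapEdge (f : ℕ → ℕ) (e : ℕ × α × ℕ) : ℕ × α × ℕ := (f e.1, e.2.1, f e.2.2)

theorem mapEdge_orientedEdge (f : ℕ → ℕ) (u v : ℕ) (l : α × Bool) :
    mapEdge f (orientedEdge u l v) = orientedEdge (f u) l (f v) := by
  rcases l with ⟨s, _ | _⟩ <;> simp [orientedEdge, mapEdge]

theorem IsPathIn.map (f : ℕ → ℕ) {G : Finset (ℕ × α × ℕ)} {u v : ℕ} {L : List (α × Bool)}
    (h : IsPathIn G u L v) : IsPathIn (G.image (mapEdge f)) (f u) L (f v) := by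
  induction L generalizing u with
  | nil => exact congrArg f h
  | cons l L ih =>
    obtain ⟨x, hx, hL⟩ := h
    exact ⟨f x, mapEdge_orientedEdge f u x l ▸ Finset.mem_image_of_mem _ hx, ih hL⟩

/-- A labelled graph is folded if no two edges with the same label share an origin or an end. -/
def IsFolded (G : Finset (ℕ × α × ℕ)) : Prop :=
  ∀ u l a b, orientedEdge u l a ∈ G → orientedEdge u l b ∈ G → a = b

theorem IsFolded.path_unique {G : Finset (ℕ × α × ℕ)} (hG : IsFolded G) {u v v' : ℕ}
    {L : List (α × Bool)} (h : IsPathIn G u L v) (h' : IsPathIn G u L v') : v = v' := by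
  induction L generalizing u with
  | nil => exact h.symm.trans h'
  | cons l L ih =>
    obtain ⟨x, hx, hL⟩ := h
    obtain ⟨x', hx', hL'⟩ := h'
    obtain rfl := hG _ _ _ _ hx hx'
    exact ih hL hL'

/-- In a folded graph, reading a letter and then its inverse leads back to the starting vertex, so a
cancelling pair can be cut out of the path. -/
theorem IsFolded.path_red {G : Finset (ℕ × α × ℕ)} (hG : IsFolded G) {u v : ℕ}
    {L L' : List (α × Bool)} (h : IsPathIn G u L v) (hr : FreeGroup.Red L L') :
    IsPathIn G u L' v := by
  induction hr with
  | refl => exact h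
  | tail _ hs ih =>
    rcases hs with @⟨L₁, L₂, x, b⟩
    · rw [isPathIn_append] at ih ⊢
      obtain ⟨y, h₁, z, hz, t, ht, h₂⟩ := ih
      have : y = t := by
        refine hG z (x, !b) y t ?_ ht
        simpa using (orientedEdge_inv z y (x, b)) ▸ hz
      exact ⟨y, h₁, this ▸ h₂⟩

theorem IsFolded.path_toWord {G : Finset (ℕ × α × ℕ)} (hG : IsFolded G) {u v : ℕ}
    {L : List (α × Bool)} (h : IsPathIn G u L v) :
    IsPathIn G u (FreeGroup.mk L).toWord v :=
  hG.path_red h FreeGroup.reduce.red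

/-- `G` is a connected labelled graph on the vertex set `S`, with base point `o`. -/
structure IsConnectedGraph (S : Finset ℕ) (G : Finset (ℕ × α × ℕ)) (o : ℕ) : Prop where
  fst_mem : ∀ e ∈ G, e.1 ∈ S
  snd_mem : ∀ e ∈ G, e.2.2 ∈ S
  base_mem : o ∈ S
  reach : ∀ v ∈ S, ∃ L, IsPathIn G o L v

/-- The subgroup of labels of closed paths at `o`. -/
def loopSubgroup (G : Finset (ℕ × α × ℕ)) (o : ℕ) : Subgroup (FreeGroup α) where
  carrier := {g | ∃ L, FreeGroup.mk L = g ∧ IsPathIn G o L o}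
  one_mem' := ⟨[], rfl, rfl⟩
  mul_mem' := by
    rintro _ _ ⟨L, rfl, h⟩ ⟨L', rfl, h'⟩
    exact ⟨L ++ L', FreeGroup.mul_mk.symm, isPathIn_append.2 ⟨o, h, h'⟩⟩
  inv_mem' := by
    rintro _ ⟨L, rfl, h⟩
    exact ⟨FreeGroup.invRev L, FreeGroup.inv_mk.symm, h.invRev⟩

theorem mem_loopSubgroup {G : Finset (ℕ × α × ℕ)} {o : ℕ} {g : FreeGroup α} :
    g ∈ loopSubgroup G o ↔ ∃ L, FreeGroup.mk L = g ∧ IsPathIn G o L o := Iff.rfl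

theorem loopSubgroup_mono {G G' : Finset (ℕ × α × ℕ)} (h : G ⊆ G') (o : ℕ) :
    loopSubgroup G o ≤ loopSubgroup G' o := by
  rintro _ ⟨L, rfl, hL⟩
  exact ⟨L, rfl, hL.mono h⟩

theorem loopSubgroup_le_image (f : ℕ → ℕ) (G : Finset (ℕ × α × ℕ)) (o : ℕ) :
    loopSubgroup G o ≤ loopSubgroup (G.image (mapEdge f)) (f o) := by
  rintro _ ⟨L, rfl, hL⟩
  exact ⟨L, rfl, hL.map f⟩

/-- The map of vertices that identifies `b` with `a`. -/
def collapse (a b : ℕ) (x : ℕ) : ℕ := if x = b then a else x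

theorem collapse_mem {S : Finset ℕ} {a b x : ℕ} (ha : a ∈ S) (hab : a ≠ b) (hx : x ∈ S) :
    collapse a b x ∈ S.erase b := by
  unfold collapse
  split_ifs with h
  · exact Finset.mem_erase.2 ⟨hab, ha⟩
  · exact Finset.mem_erase.2 ⟨h, hx⟩

theorem IsConnectedGraph.collapse {S : Finset ℕ} {G : Finset (ℕ × α × ℕ)} {o : ℕ}
    (h : IsConnectedGraph S G o) {a b : ℕ} (ha : a ∈ S) (hab : a ≠ b) :
    IsConnectedGraph (S.erase b) (G.image (mapEdge (collapse a b))) (collapse a b o) where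
  fst_mem := by
    intro e he
    obtain ⟨e', he', rfl⟩ := Finset.mem_image.1 he
    exact collapse_mem ha hab (h.fst_mem e' he')
  snd_mem := by
    intro e he
    obtain ⟨e', he', rfl⟩ := Finset.mem_image.1 he
    exact collapse_mem ha hab (h.snd_mem e' he')
  base_mem := collapse_mem ha hab h.base_mem
  reach := by
    intro v hv
    obtain ⟨L, hL⟩ := h.reach v (Finset.mem_of_mem_erase hv)
    refine ⟨L, ?_⟩
    have := hL.map (_root_.collapse a b)
    rwa [show _root_.collapse a b v = v by simp [_root_.collapse, Finset.ne_of_mem_erase hv]]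
      at this

theorem IsConnectedGraph.orientedEdge_mem {S : Finset ℕ} {G : Finset (ℕ × α × ℕ)} {o : ℕ}
    (h : IsConnectedGraph S G o) {u v : ℕ} {l : α × Bool} (he : orientedEdge u l v ∈ G) :
    u ∈ S ∧ v ∈ S := by
  have h₁ := h.fst_mem _ he
  have h₂ := h.snd_mem _ he
  rcases l with ⟨s, _ | _⟩ <;> simp_all [orientedEdge]

theorem orientedEdge_right_injective (u : ℕ) (l : α × Bool) :
    Function.Injective (orientedEdge u l) := by
  intro a b h
  rcases l with ⟨s, _ | _⟩ <;> simpa [orientedEdge] using h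

/-- A graph that is not folded can be folded: identifying two suitable vertices loses an edge. -/
theorem IsConnectedGraph.exists_fold {S : Finset ℕ} {G : Finset (ℕ × α × ℕ)} {o : ℕ}
    (h : IsConnectedGraph S G o) (hG : ¬ IsFolded G) :
    ∃ a ∈ S, ∃ b ∈ S, a ≠ b ∧ (G.image (mapEdge (_root_.collapse a b))).card < G.card := by
  unfold IsFolded at hG
  push Not at hG
  obtain ⟨u, l, a, b, ha, hb, hab⟩ := hG
  refine ⟨a, (h.orientedEdge_mem ha).2, b, (h.orientedEdge_mem hb).2, hab, ?_⟩
  refine lt_of_le_of_ne Finset.card_image_le fun hc => hab ?_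
  have hinj := Finset.card_image_iff.1 hc
  refine orientedEdge_right_injective u l (hinj ha hb ?_)
  simp [mapEdge_orientedEdge, _root_.collapse, hab]

/-- Every connected graph folds onto a folded one, without increasing the rank. -/
theorem IsConnectedGraph.exists_folded {S : Finset ℕ} {G : Finset (ℕ × α × ℕ)} {o : ℕ}
    (h : IsConnectedGraph S G o) :
    ∃ S' G' o', IsConnectedGraph S' G' o' ∧ G'.card + S.card ≤ G.card + S'.card ∧ IsFolded G' ∧
      loopSubgroup G o ≤ loopSubgroup G' o' := by
  induction hn : S.card generalizing S G o with
  | zero =>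
    have := h.base_mem
    simp [Finset.card_eq_zero.1 hn] at this
  | succ n ih =>
    by_cases hG : IsFolded G
    · exact ⟨S, G, o, h, by omega, hG, le_rfl⟩
    -- A fold removes exactly one vertex and at least one edge, so `|E| - |V|` does not grow.
    obtain ⟨a, ha, b, hb, hab, hlt⟩ := h.exists_fold hG
    have hc := Finset.card_erase_of_mem hb
    obtain ⟨S', G', o', h', hm', hf, hl⟩ := ih (h.collapse ha hab) (by omega)
    exact ⟨S', G', o', h', by omega, hf, (loopSubgroup_le_image _ _ _).trans hl⟩

/-- A word leading from `o` to `v` also represents the label of a loop at `o`. After reduction, both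
paths read the same word from `o`, so their ends agree. -/
theorem IsFolded.eq_singleton_of_loopSubgroup_eq_top {S : Finset ℕ} {G : Finset (ℕ × α × ℕ)}
    {o : ℕ} (hG : IsFolded G) (h : IsConnectedGraph S G o) (ht : loopSubgroup G o = ⊤) :
    S = {o} := by
  refine Finset.eq_singleton_iff_unique_mem.2 ⟨h.base_mem, fun v hv => ?_⟩
  obtain ⟨L, hL⟩ := h.reach v hv
  obtain ⟨L', hL', hp⟩ := mem_loopSubgroup.1 (ht ▸ Subgroup.mem_top (FreeGroup.mk L))
  exact hG.path_unique (hG.path_toWord hL) (hL' ▸ hG.path_toWord hp)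

theorem IsFolded.card_le_card_of_loopSubgroup_eq_top [Fintype α] {G : Finset (ℕ × α × ℕ)} {o : ℕ}
    (hG : IsFolded G) (ht : loopSubgroup G o = ⊤) : Fintype.card α ≤ G.card := by
  rw [← Finset.card_univ]
  refine Finset.card_le_card_of_injOn (fun s => (o, s, o)) (fun s _ => ?_) (by intro; simp)
  obtain ⟨L', hL', hp⟩ := mem_loopSubgroup.1 (ht ▸ Subgroup.mem_top (FreeGroup.of s))
  have := hG.path_toWord hp
  rw [hL', FreeGroup.toWord_of] at this
  obtain ⟨x, hx, rfl⟩ := this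
  simpa [orientedEdge] using hx

/-- A connected graph whose closed paths carry all of the free group has at least its rank. -/
theorem IsConnectedGraph.card_add_le [Fintype α] {S : Finset ℕ} {G : Finset (ℕ × α × ℕ)} {o : ℕ}
    (h : IsConnectedGraph S G o) (ht : loopSubgroup G o = ⊤) :
    S.card + Fintype.card α ≤ G.card + 1 := by
  obtain ⟨S', G', o', h', hm', hf, hl⟩ := h.exists_folded
  have ht' : loopSubgroup G' o' = ⊤ := top_le_iff.1 (ht ▸ hl)
  have h₁ := hf.card_le_card_of_loopSubgroup_eq_top ht'
  have h₂ := hf.eq_singleton_of_loopSubgroup_eq_top h' ht'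
  have h₃ : S'.card = 1 := by simp [h₂]
  omega

/-- A path labelled by a nonempty word can be attached between two vertices of a connected graph,
increasing the rank by at most one. -/
theorem IsConnectedGraph.exists_attach {S : Finset ℕ} {G : Finset (ℕ × α × ℕ)} {o : ℕ}
    (h : IsConnectedGraph S G o) {u z : ℕ} (hu : u ∈ S) (hz : z ∈ S) (l : α × Bool)
    (L : List (α × Bool)) :
    ∃ S' G', IsConnectedGraph S' G' o ∧ G ⊆ G' ∧ G'.card + S.card ≤ G.card + S'.card + 1 ∧
      IsPathIn G' u (l :: L) z := by
  induction L generalizing S G u l with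
  | nil =>
    refine ⟨S, insert (orientedEdge u l z) G, ⟨?_, ?_, h.base_mem, ?_⟩, Finset.subset_insert _ _,
      ?_, z, Finset.mem_insert_self _ _, rfl⟩
    · refine Finset.forall_mem_insert _ _ _ |>.2 ⟨?_, h.fst_mem⟩
      rcases l with ⟨s, _ | _⟩ <;> simp [orientedEdge, hu, hz]
    · refine Finset.forall_mem_insert _ _ _ |>.2 ⟨?_, h.snd_mem⟩
      rcases l with ⟨s, _ | _⟩ <;> simp [orientedEdge, hu, hz]
    · intro v hv
      obtain ⟨L, hL⟩ := h.reach v hv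
      exact ⟨L, hL.mono (Finset.subset_insert _ _)⟩
    · have := Finset.card_insert_le (orientedEdge u l z) G
      omega
  | cons l' L ih =>
    obtain ⟨x, hx⟩ := Infinite.exists_notMem_finset S
    have h' : IsConnectedGraph (insert x S) (insert (orientedEdge u l x) G) o := by
      refine ⟨?_, ?_, Finset.mem_insert_of_mem h.base_mem, ?_⟩
      · refine Finset.forall_mem_insert _ _ _ |>.2
          ⟨?_, fun e he => Finset.mem_insert_of_mem (h.fst_mem e he)⟩
        rcases l with ⟨s, _ | _⟩ <;> simp [orientedEdge, hu]
      · refine Finset.forall_mem_insert _ _ _ |>.2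
          ⟨?_, fun e he => Finset.mem_insert_of_mem (h.snd_mem e he)⟩
        rcases l with ⟨s, _ | _⟩ <;> simp [orientedEdge, hu]
      · refine Finset.forall_mem_insert _ _ _ |>.2 ⟨?_, fun v hv => ?_⟩
        · obtain ⟨L₀, hL₀⟩ := h.reach u hu
          exact ⟨L₀ ++ [l], isPathIn_append.2 ⟨u, hL₀.mono (Finset.subset_insert _ _), x,
            Finset.mem_insert_self _ _, rfl⟩⟩
        · obtain ⟨L, hL⟩ := h.reach v hv
          exact ⟨L, hL.mono (Finset.subset_insert _ _)⟩
    obtain ⟨S', G', hc, hsub, hcard, hp⟩ :=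
      ih h' (Finset.mem_insert_self x S) (Finset.mem_insert_of_mem hz) l'
    refine ⟨S', G', hc, (Finset.subset_insert _ _).trans hsub, ?_,
      x, hsub (Finset.mem_insert_self _ _), hp⟩
    have h₁ := Finset.card_insert_le (orientedEdge u l x) G
    have h₂ := Finset.card_insert_of_notMem hx
    omega

/-- Attaching a loop labelled by a given element of the free group. -/
theorem IsConnectedGraph.exists_attach_loop {S : Finset ℕ} {G : Finset (ℕ × α × ℕ)} {o : ℕ}
    (h : IsConnectedGraph S G o) (g : FreeGroup α) :
    ∃ S' G', IsConnectedGraph S' G' o ∧ G ⊆ G' ∧ G'.card + S.card ≤ G.card + S'.card + 1 ∧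
      g ∈ loopSubgroup G' o := by
  rcases hg : g.toWord with _ | ⟨l, L⟩
  · rw [FreeGroup.toWord_eq_nil_iff] at hg
    exact ⟨S, G, h, subset_rfl, by omega, hg ▸ one_mem _⟩
  · obtain ⟨S', G', hc, hsub, hcard, hp⟩ := h.exists_attach h.base_mem h.base_mem l L
    exact ⟨S', G', hc, hsub, hcard, l :: L, by rw [← hg, FreeGroup.mk_toWord], hp⟩

/-- A finitely generated subgroup is carried by a connected graph whose rank is at most the number
of generators. -/
theorem exists_isConnectedGraph (B : List (FreeGroup α)) :
    ∃ S G o, IsConnectedGraph S G o ∧ G.card + 1 ≤ S.card + B.length ∧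
      Subgroup.closure {g | g ∈ B} ≤ loopSubgroup G o := by
  induction B with
  | nil =>
    refine ⟨{0}, ∅, 0, ⟨by simp, by simp, by simp, fun v hv => ⟨[], ?_⟩⟩, by simp, by simp⟩
    exact (Finset.mem_singleton.1 hv).symm
  | cons g B ih =>
    obtain ⟨S, G, o, hc, hcard, hB⟩ := ih
    obtain ⟨S', G', hc', hsub, hcard', hg⟩ := hc.exists_attach_loop g
    refine ⟨S', G', o, hc', by simp only [List.length_cons]; omega, ?_⟩
    rw [Subgroup.closure_le]
    intro x hx
    rcases List.mem_cons.1 hx with rfl | hx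
    · exact hg
    · exact loopSubgroup_mono hsub o (hB (Subgroup.subset_closure hx))

theorem IsPathIn.exists_crossing {G : Finset (ℕ × α × ℕ)} {S : Finset ℕ} {u v : ℕ}
    {L : List (α × Bool)} (h : IsPathIn G u L v) (hu : u ∈ S) (hv : v ∉ S) :
    ∃ x ∈ S, ∃ y ∉ S, ∃ l, orientedEdge x l y ∈ G := by
  induction L generalizing u with
  | nil => exact absurd (h ▸ hu) hv
  | cons l L ih =>
    obtain ⟨x, hx, hL⟩ := h
    by_cases hxS : x ∈ S
    · exact ih hL hxS
    · exact ⟨u, hu, x, hxS, l, hx⟩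

/-- A nonempty subgraph of a connected graph has at most its rank. -/
theorem IsConnectedGraph.card_subgraph_le {S : Finset ℕ} {G : Finset (ℕ × α × ℕ)} {o : ℕ}
    (h : IsConnectedGraph S G o) {S' : Finset ℕ} {G' : Finset (ℕ × α × ℕ)} (hS : S' ⊆ S)
    (hG : G' ⊆ G) (hne : S'.Nonempty) (hmem : ∀ e ∈ G', e.1 ∈ S' ∧ e.2.2 ∈ S') :
    G'.card + S.card ≤ G.card + S'.card := by
  induction hn : (S \ S').card generalizing S' G' with
  | zero =>
    have : S = S' := (Finset.sdiff_eq_empty_iff_subset.1 (Finset.card_eq_zero.1 hn)).antisymm hS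
    subst this
    have := Finset.card_le_card hG
    omega
  | succ n ih =>
    obtain ⟨v, hv⟩ : (S \ S').Nonempty := Finset.card_pos.1 (by omega)
    rw [Finset.mem_sdiff] at hv
    obtain ⟨s, hs⟩ := hne
    obtain ⟨L₁, h₁⟩ := h.reach s (hS hs)
    obtain ⟨L₂, h₂⟩ := h.reach v hv.1
    -- The path from `s` to `v` through the base point leaves `S'` along some edge. Adding that edge
    -- and its outer end changes both cardinalities by one, so the difference is preserved.
    obtain ⟨x, hx, y, hy, l, hl⟩ :=
      IsPathIn.exists_crossing (isPathIn_append.2 ⟨o, h₁.invRev, h₂⟩) hs hv.2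
    have hyS := (h.orientedEdge_mem hl).2
    have hnot : orientedEdge x l y ∉ G' := by
      intro hmem'
      have := hmem _ hmem'
      rcases l with ⟨s, _ | _⟩ <;> simp_all [orientedEdge]
    have key := ih (S' := insert y S') (G' := insert (orientedEdge x l y) G')
      (Finset.insert_subset hyS hS) (Finset.insert_subset hl hG) (Finset.insert_nonempty _ _)
      (by
        refine Finset.forall_mem_insert _ _ _ |>.2 ⟨?_, fun e he => ?_⟩
        · rcases l with ⟨s, _ | _⟩ <;> simp [orientedEdge, hx]
        · exact ⟨Finset.mem_insert_of_mem (hmem e he).1, Finset.mem_insert_of_mem (hmem e he).2⟩)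
      (by
        rw [Finset.sdiff_insert, Finset.card_erase_of_mem (Finset.mem_sdiff.2 ⟨hyS, hy⟩), hn]
        rfl)
    rw [Finset.card_insert_of_notMem hnot, Finset.card_insert_of_notMem hy] at key
    omega

/-- The edges traced by a closed path with vertices `p` and letters `ℓ`. -/
def tracedEdges {N : ℕ} [NeZero N] (ℓ : ZMod N → α × Bool) (p : ZMod N → ℕ) :
    Finset (ℕ × α × ℕ) :=
  Finset.univ.image fun i => orientedEdge (p i) (ℓ i) (p (i + 1))

/-- The vertices traced by a closed path. -/
def tracedVertices {N : ℕ} [NeZero N] (p : ZMod N → ℕ) : Finset ℕ := Finset.univ.image p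

theorem IsConnectedGraph.card_traced_le {S : Finset ℕ} {G : Finset (ℕ × α × ℕ)} {o : ℕ}
    (h : IsConnectedGraph S G o) {N : ℕ} [NeZero N] {ℓ : ZMod N → α × Bool} {p : ZMod N → ℕ}
    (hp : tracedEdges ℓ p ⊆ G) :
    (tracedEdges ℓ p).card + S.card ≤ G.card + (tracedVertices p).card := by
  have hmem : ∀ i, orientedEdge (p i) (ℓ i) (p (i + 1)) ∈ G :=
    fun i => hp (Finset.mem_image_of_mem _ (Finset.mem_univ i))
  refine h.card_subgraph_le ?_ hp ⟨p 0, Finset.mem_image_of_mem _ (Finset.mem_univ 0)⟩ ?_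
  · intro v hv
    obtain ⟨i, -, rfl⟩ := Finset.mem_image.1 hv
    exact (h.orientedEdge_mem (hmem i)).1
  · intro e he
    obtain ⟨i, -, rfl⟩ := Finset.mem_image.1 he
    have h₁ : ∀ i, p i ∈ tracedVertices p := fun i => Finset.mem_image_of_mem _ (Finset.mem_univ i)
    have h₂ := h₁ i
    have h₃ := h₁ (i + 1)
    rcases hl : ℓ i with ⟨s, _ | _⟩ <;> simp [orientedEdge, h₂, h₃]

theorem tracedEdges_comp (f : ℕ → ℕ) {N : ℕ} [NeZero N] (ℓ : ZMod N → α × Bool)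
    (p : ZMod N → ℕ) :
    tracedEdges ℓ (f ∘ p) = (tracedEdges ℓ p).image (mapEdge f) := by
  simp [tracedEdges, Finset.image_image, Function.comp_def, mapEdge_orientedEdge]

/-- Folding one pair of edges at a time, a closed path in a graph of minimal rank carrying the
whole free group passes through a stage where it traces any prescribed number of edges. -/
theorem IsConnectedGraph.exists_card_tracedEdges_eq [Fintype α] {S : Finset ℕ}
    {G : Finset (ℕ × α × ℕ)} {o : ℕ} (h : IsConnectedGraph S G o) (ht : loopSubgroup G o = ⊤)
    (hm : G.card + 1 ≤ S.card + Fintype.card α) {N : ℕ} [NeZero N] {ℓ : ZMod N → α × Bool}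
    {p : ZMod N → ℕ} (hp : tracedEdges ℓ p ⊆ G) {D : ℕ} (hD : Fintype.card α ≤ D)
    (hDp : D ≤ (tracedEdges ℓ p).card) :
    ∃ q : ZMod N → ℕ, (tracedEdges ℓ q).card = D ∧
      (tracedEdges ℓ q).card + 1 ≤ (tracedVertices q).card + Fintype.card α := by
  induction hn : S.card generalizing S G o p with
  | zero =>
    have := h.base_mem
    simp [Finset.card_eq_zero.1 hn] at this
  | succ n ih =>
    rcases hDp.eq_or_lt with heq | hlt
    · have := h.card_traced_le hp
      exact ⟨p, heq.symm, by omega⟩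
    by_cases hG : IsFolded G
    · have h₁ := hG.eq_singleton_of_loopSubgroup_eq_top h ht
      have h₂ : S.card = 1 := by simp [h₁]
      have := Finset.card_le_card hp
      omega
    obtain ⟨a, ha, b, hb, hab, hfold⟩ := h.exists_fold hG
    have hc := Finset.card_erase_of_mem hb
    have h' := h.collapse ha hab
    have ht' : loopSubgroup (G.image (mapEdge (_root_.collapse a b))) (_root_.collapse a b o) = ⊤ :=
      top_le_iff.1 (ht ▸ loopSubgroup_le_image _ _ _)
    -- The rank is at most `k` by `hm` and cannot fall below `k` while the loops carry the whole
    -- group. So the fold loses exactly one edge, and the trace loses at most one: it cannot jump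
    -- past `D`.
    have hr := h'.card_add_le ht'
    refine ih h' ht' (by omega) (p := _root_.collapse a b ∘ p) ?_ ?_ (by omega)
    · rw [tracedEdges_comp]
      exact Finset.image_subset_image hp
    · rw [tracedEdges_comp]
      have h₁ : (G.image (mapEdge (_root_.collapse a b))).card ≤
          ((tracedEdges ℓ p).image (mapEdge (_root_.collapse a b))).card +
            (G \ tracedEdges ℓ p).card := by
        have hu : G = tracedEdges ℓ p ∪ (G \ tracedEdges ℓ p) :=
          (Finset.union_sdiff_of_subset hp).symm
        conv_lhs => rw [hu, Finset.image_union]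
        exact (Finset.card_union_le _ _).trans (Nat.add_le_add_left Finset.card_image_le _)
      have h₂ := Finset.card_sdiff_add_card_eq_card hp
      omega

theorem IsPathIn.exists_vertices {G : Finset (ℕ × α × ℕ)} {u v : ℕ} {L : List (α × Bool)}
    (h : IsPathIn G u L v) :
    ∃ q : ℕ → ℕ, q 0 = u ∧ q L.length = v ∧
      ∀ (i : ℕ) (hi : i < L.length), orientedEdge (q i) L[i] (q (i + 1)) ∈ G := by
  induction L generalizing u with
  | nil => exact ⟨fun _ => u, rfl, h, by simp⟩
  | cons l L ih =>
    obtain ⟨x, hx, hL⟩ := h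
    obtain ⟨q, h0, hlen, hq⟩ := ih hL
    refine ⟨fun i => i.casesOn u q, rfl, hlen, fun i hi => ?_⟩
    rcases i with _ | i
    · simpa [h0] using hx
    · simpa using hq i (by simpa using hi)

theorem IsPathIn.exists_tracedEdges {G : Finset (ℕ × α × ℕ)} {u : ℕ} {L : List (α × Bool)}
    (h : IsPathIn G u L u) [NeZero L.length] :
    ∃ p : ZMod L.length → ℕ, tracedEdges (fun i => L[i.val]'(ZMod.val_lt i)) p ⊆ G := by
  obtain ⟨q, h0, hlen, hq⟩ := h.exists_vertices
  refine ⟨fun i => q i.val, fun e he => ?_⟩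
  obtain ⟨i, -, rfl⟩ := Finset.mem_image.1 he
  have hi := hq i.val (ZMod.val_lt i)
  have : q (i + 1).val = q (i.val + 1) := by
    rcases lt_or_eq_of_le (Nat.succ_le_of_lt (ZMod.val_lt i)) with hlt | heq
    · rw [ZMod.val_add, ZMod.val_one_eq_one_mod, Nat.add_mod_mod, Nat.mod_eq_of_lt hlt]
    · have hz : i + 1 = 0 := by
        have : ((i.val + 1 : ℕ) : ZMod L.length) = 0 := by
          rw [← Nat.succ_eq_add_one, heq, ZMod.natCast_self]
        simpa using this
      rw [hz, ZMod.val_zero, h0, ← Nat.succ_eq_add_one, heq, hlen]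
  simpa only [this] using hi

/-- A nontrivial element, given by a reduced word, of a subgroup generated by all but one of `k`
elements that generate the free group of rank `k` is traced by a closed path in a graph with at
most `D` edges and rank less than `k`, or with exactly `D` edges and rank at most `k`. -/
theorem exists_closed_path [Fintype α] (B : List (FreeGroup α)) (b : FreeGroup α)
    (hB : B.length + 1 = Fintype.card α) (htop : Subgroup.closure {g | g ∈ b :: B} = ⊤)
    {L : List (α × Bool)} [NeZero L.length] (hL : FreeGroup.IsReduced L)
    (hmem : FreeGroup.mk L ∈ Subgroup.closure {g | g ∈ B}) {D : ℕ} (hD : Fintype.card α ≤ D) :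
    ∃ p : ZMod L.length → ℕ,
      let ℓ : ZMod L.length → α × Bool := fun i => L[i.val]'(ZMod.val_lt i)
      ((tracedEdges ℓ p).card ≤ D ∧
        (tracedEdges ℓ p).card + 2 ≤ (tracedVertices p).card + Fintype.card α) ∨
      ((tracedEdges ℓ p).card = D ∧
        (tracedEdges ℓ p).card + 1 ≤ (tracedVertices p).card + Fintype.card α) := by
  obtain ⟨S₀, G₀, o₀, hc₀, hcard₀, hB₀⟩ := exists_isConnectedGraph B
  obtain ⟨S, G, o, hc, hcard, hf, hle⟩ := hc₀.exists_folded
  obtain ⟨L', hL', hpath⟩ := mem_loopSubgroup.1 (hle (hB₀ hmem))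
  have hpL : IsPathIn G o L o := by
    have := hf.path_toWord hpath
    rwa [hL', FreeGroup.toWord_mk, hL.reduce_eq] at this
  obtain ⟨p, hp⟩ := hpL.exists_tracedEdges
  -- A small trace inherits rank at most `k - 1`. A large one is folded down to `D` edges, after `b`
  -- has been attached to make the loops carry the whole group.
  rcases le_or_gt (tracedEdges (fun i => L[i.val]'(ZMod.val_lt i)) p).card D with hlt | hgt
  · have := hc.card_traced_le hp
    exact ⟨p, Or.inl ⟨hlt, by omega⟩⟩
  · obtain ⟨S', G', hc', hsub, hcard', hb⟩ := hc.exists_attach_loop b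
    have ht : loopSubgroup G' o = ⊤ := by
      refine top_le_iff.1 (htop ▸ ?_)
      rw [Subgroup.closure_le]
      intro x hx
      rcases List.mem_cons.1 hx with rfl | hx
      · exact hb
      · exact loopSubgroup_mono hsub o (hle (hB₀ (Subgroup.subset_closure hx)))
    obtain ⟨q, hq⟩ := hc'.exists_card_tracedEdges_eq ht (by omega) (hp.trans hsub) hD hgt.le
    exact ⟨q, Or.inr hq⟩

end Folding

/-! ### Traversal frequencies of a reduced tour of a graph of bounded rank. -/

section Tours

variable {X V : Type*} [Fintype X] [DecidableEq X] [Fintype V] [DecidableEq V]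

/-- The number of darts in `H` with origin `v`. -/
def dartDegree (src : X → V) (H : Finset X) (v : V) : ℕ := (H.filter fun x => src x = v).card

theorem sum_dartDegree (src : X → V) (H : Finset X) (W : Finset V) (hW : ∀ x ∈ H, src x ∈ W) :
    ∑ v ∈ W, dartDegree src H v = H.card :=
  (Finset.card_eq_sum_card_fiberwise hW).symm

theorem dartDegree_mono (src : X → V) {H H' : Finset X} (h : H ⊆ H') (v : V) :
    dartDegree src H v ≤ dartDegree src H' v :=
  Finset.card_le_card (Finset.filter_subset_filter _ h)

/-- If all vertices of the subgraph `H` have degree at least two, the degree of a vertex is bounded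
in terms of the rank. -/
theorem dartDegree_add_le (src : X → V) (H : Finset X) (W : Finset V)
    (hW : ∀ x ∈ H, src x ∈ W) (h2 : ∀ v ∈ W, 2 ≤ dartDegree src H v) {v : V} (hv : v ∈ W) :
    dartDegree src H v + 2 * W.card ≤ H.card + 2 := by
  rw [← sum_dartDegree src H W hW, ← Finset.add_sum_erase W _ hv]
  have h₁ : (W.erase v).card • 2 ≤ ∑ x ∈ W.erase v, dartDegree src H x :=
    Finset.card_nsmul_le_sum _ _ _ fun x hx => h2 x (Finset.mem_of_mem_erase hx)
  have h₂ := Finset.card_erase_add_one hv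
  simp only [smul_eq_mul] at h₁
  omega

/-- In `dartDegree_subgraph_le` this parity upgrades the loss of one dart to the loss of a whole
edge. -/
theorem even_card_of_involutive {inv : X → X} (hinv : Function.Involutive inv)
    (hne : ∀ x, inv x ≠ x) {H : Finset X} (hH : ∀ x ∈ H, inv x ∈ H) : Even H.card := by
  have : ∑ x ∈ H, (1 : ZMod 2) = 0 :=
    Finset.sum_involution (fun x _ => inv x) (fun _ _ => by decide) (fun x _ _ => hne x)
      (fun x hx => hH x hx) (fun x _ => hinv x)
  rw [Finset.sum_const, nsmul_eq_mul, mul_one] at this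
  exact (ZMod.natCast_eq_zero_iff_even).1 this

/-- A closed reduced tour, with darts `o i`, covering a graph (in the sense of Serre) with set of
darts `X`, set of vertices `V`, inversion `inv` and origin map `src`. -/
structure IsReducedTour (inv : X → X) (src : X → V) {N : ℕ} [NeZero N] (o : ZMod N → X) :
    Prop where
  involutive : Function.Involutive inv
  inv_ne : ∀ x, inv x ≠ x
  surjective : Function.Surjective src
  src_succ : ∀ i, src (o (i + 1)) = src (inv (o i))
  reduced : ∀ i, o (i + 1) ≠ inv (o i)
  cover : ∀ x, (∃ i, o i = x) ∨ ∃ i, o i = inv x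

/-- The number of times the tour traverses the dart `x`, in either direction. -/
def traversals (inv : X → X) {N : ℕ} [NeZero N] (o : ZMod N → X) (x : X) : ℕ :=
  (Finset.univ.filter fun i => o i = x).card + (Finset.univ.filter fun i => o i = inv x).card

namespace IsReducedTour

variable {inv : X → X} {src : X → V} {N : ℕ} [NeZero N] {o : ZMod N → X}

theorem exists_src_eq (h : IsReducedTour inv src o) (v : V) : ∃ i, src (o i) = v := by
  obtain ⟨x, rfl⟩ := h.surjective v
  rcases h.cover x with ⟨i, rfl⟩ | ⟨i, hi⟩
  · exact ⟨i, rfl⟩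
  · exact ⟨i + 1, by rw [h.src_succ, hi, h.involutive]⟩

theorem two_le_dartDegree (h : IsReducedTour inv src o)
    (v : V) : 2 ≤ dartDegree src Finset.univ v := by
  obtain ⟨i, hi⟩ := h.exists_src_eq v
  obtain ⟨j, rfl⟩ : ∃ j, i = j + 1 := ⟨i - 1, by ring⟩
  have : ({o (j + 1), inv (o j)} : Finset X).card = 2 := Finset.card_pair (h.reduced j)
  rw [← this]
  refine Finset.card_le_card fun x hx => ?_
  rcases Finset.mem_insert.1 hx with rfl | hx
  · simpa using hi
  · rw [Finset.mem_singleton.1 hx]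
    simpa [← h.src_succ] using hi

theorem dartDegree_le (h : IsReducedTour inv src o)
    {r : ℕ} (hr : Fintype.card X ≤ 2 * Fintype.card V + r) (v : V) :
    dartDegree src Finset.univ v ≤ r + 2 := by
  have := dartDegree_add_le src Finset.univ Finset.univ (by simp)
    (fun v _ => h.two_le_dartDegree v) (Finset.mem_univ v)
  simp only [Finset.card_univ] at this
  omega

/-- In a graph of rank at most `r + 1`, each dart has at most `2 r + 1` reduced continuations. -/
theorem card_continuations_le (h : IsReducedTour inv src o)
    {r : ℕ} (hr : Fintype.card X ≤ 2 * Fintype.card V + 2 * r) (x : X) :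
    (Finset.univ.filter fun y => src y = src (inv x) ∧ y ≠ inv x).card ≤ 2 * r + 1 := by
  have h₁ := h.dartDegree_le hr (src (inv x))
  have h₂ : (Finset.univ.filter fun y => src y = src (inv x) ∧ y ≠ inv x) =
      (Finset.univ.filter fun y => src y = src (inv x)).erase (inv x) := by
    ext y; simp [and_comm]
  rw [h₂, Finset.card_erase_of_mem (by simp)]
  unfold dartDegree at h₁
  omega

theorem traversals_inv (h : IsReducedTour inv src o)
    (x : X) : traversals inv o (inv x) = traversals inv o x := by
  unfold traversals
  rw [h.involutive, add_comm]

theorem sum_traversals (h : IsReducedTour inv src o) (A : Finset X) : ∑ x ∈ A, traversals inv o x =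
    (Finset.univ.filter fun i => o i ∈ A).card +
      (Finset.univ.filter fun i => inv (o i) ∈ A).card := by
  unfold traversals
  rw [Finset.sum_add_distrib]
  congr 1
  · rw [Finset.card_eq_sum_card_fiberwise (f := o) (t := A) (by intro i; simp)]
    refine Finset.sum_congr rfl fun x hx => congrArg _ ?_
    ext i
    simp only [Finset.mem_filter, Finset.mem_univ, true_and]
    exact ⟨fun hi => ⟨hi ▸ hx, hi⟩, fun hi => hi.2⟩
  · rw [Finset.card_eq_sum_card_fiberwise (f := fun i => inv (o i)) (t := A) (by intro i; simp)]
    refine Finset.sum_congr rfl fun x hx => congrArg _ ?_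
    ext i
    simp only [Finset.mem_filter, Finset.mem_univ, true_and]
    constructor
    · intro hi
      rw [hi, h.involutive]
      exact ⟨hx, rfl⟩
    · intro hi
      rw [← hi.2, h.involutive]

theorem exists_traversals_le (h : IsReducedTour inv src o)
    {D : ℕ} (hD : 0 < D) (hX : Fintype.card X = 2 * D) :
    ∃ x, traversals inv o x ≤ N / D := by
  by_contra! hlt
  have h₁ : (Finset.univ : Finset X).card • (N / D + 1) ≤ ∑ x, traversals inv o x :=
    Finset.card_nsmul_le_sum _ _ _ fun x _ => hlt x
  rw [h.sum_traversals] at h₁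
  simp only [Finset.mem_univ, Finset.filter_true, Finset.card_univ, ZMod.card, hX,
    smul_eq_mul] at h₁
  have := Nat.lt_mul_div_succ N hD
  nlinarith

/-- A reduced tour that arrives at a vertex along one edge direction must depart by another dart:
each passage through `f` is matched with the neighbouring step at the origin of `f`. -/
theorem traversals_le_sum (h : IsReducedTour inv src o) (f : X) : traversals inv o f ≤
    ∑ x ∈ (Finset.univ.filter fun x => src x = src f).erase f, traversals inv o x := by
  rw [h.sum_traversals, add_comm, traversals]
  refine add_le_add ?_ ?_
  · refine Finset.card_le_card_of_injOn (fun i => i - 1) (fun i hi => ?_) (by intro; simp)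
    simp only [Finset.coe_filter, Finset.mem_univ, true_and, Set.mem_ofPred_eq] at hi
    have h₁ := h.src_succ (i - 1)
    have h₂ := h.reduced (i - 1)
    rw [sub_add_cancel, hi] at h₁ h₂
    simp [h₁.symm, h₂.symm]
  · refine Finset.card_le_card_of_injOn (fun i => i + 1) (fun i hi => ?_) (by intro; simp)
    simp only [Finset.coe_filter, Finset.mem_univ, true_and, Set.mem_ofPred_eq] at hi
    have h₁ := h.src_succ i
    have h₂ := h.reduced i
    rw [hi, h.involutive] at h₁ h₂
    simp [h₁, h₂]

/-- If exactly one dart at `v` is traversed more than `t` times, then `v` is a branch point, and all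
darts at `v` are traversed rarely. -/
theorem of_dartDegree_eq_one (h : IsReducedTour inv src o)
    {r t : ℕ} (hr : Fintype.card X ≤ 2 * Fintype.card V + r) {v : V}
    (hv : dartDegree src (Finset.univ.filter fun x => t < traversals inv o x) v = 1) :
    3 ≤ dartDegree src Finset.univ v ∧ (∃ x, src x = v ∧ t < traversals inv o x) ∧
      ∀ x, src x = v → traversals inv o x ≤ t * (r + 2) := by
  obtain ⟨f, hf⟩ := Finset.card_eq_one.1 hv
  have hmem : ∀ x, (t < traversals inv o x ∧ src x = v) ↔ x = f := by
    intro x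
    have := Finset.ext_iff.1 hf x
    simpa using this
  obtain ⟨hft, rfl⟩ := (hmem f).2 rfl
  have h₁ := h.traversals_le_sum f
  have h₂ : ∑ x ∈ (Finset.univ.filter fun x => src x = src f).erase f, traversals inv o x ≤
      ((Finset.univ.filter fun x => src x = src f).erase f).card • t := by
    refine Finset.sum_le_card_nsmul _ _ _ fun x hx => ?_
    simp only [Finset.mem_erase, Finset.mem_filter, Finset.mem_univ, true_and] at hx
    by_contra! hlt
    exact hx.1 ((hmem x).1 ⟨hlt, hx.2⟩)
  rw [Finset.card_erase_of_mem (by simp), smul_eq_mul] at h₂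
  have h₃ := h.dartDegree_le hr (src f)
  change _ ≤ (dartDegree src Finset.univ (src f) - 1) * t at h₂
  refine ⟨?_, ⟨f, rfl, hft⟩, fun x hx => ?_⟩
  · by_contra! hlt
    have : (dartDegree src Finset.univ (src f) - 1) * t ≤ 1 * t := Nat.mul_le_mul_right _ (by omega)
    omega
  · by_cases hxf : x = f
    · have : (dartDegree src Finset.univ (src f) - 1) * t ≤ (r + 2) * t :=
        Nat.mul_le_mul_right _ (by omega)
      rw [hxf]
      nlinarith
    · have : ¬ t < traversals inv o x := fun hlt => hxf ((hmem x).1 ⟨hlt, hx⟩)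
      nlinarith

theorem sum_dartDegree_sub_two (h : IsReducedTour inv src o)
    {r : ℕ} (hr : Fintype.card X ≤ 2 * Fintype.card V + r)
    (W : Finset V) : ∑ v ∈ W, (dartDegree src Finset.univ v - 2) ≤ r := by
  have h₁ : ∑ v ∈ W, (dartDegree src Finset.univ v - 2) ≤
      ∑ v, (dartDegree src Finset.univ v - 2) :=
    Finset.sum_le_sum_of_subset (Finset.subset_univ _)
  have h₂ : ∑ v, (dartDegree src Finset.univ v - 2) + ∑ _v : V, 2 =
      ∑ v, dartDegree src Finset.univ v := by
    rw [← Finset.sum_add_distrib]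
    exact Finset.sum_congr rfl fun v _ => Nat.sub_add_cancel (h.two_le_dartDegree v)
  rw [sum_dartDegree src Finset.univ Finset.univ (by simp)] at h₂
  simp only [Finset.sum_const, Finset.card_univ, smul_eq_mul] at h₂
  omega

theorem card_branch_le (h : IsReducedTour inv src o)
    {r : ℕ} (hr : Fintype.card X ≤ 2 * Fintype.card V + r) :
    (Finset.univ.filter fun v => 3 ≤ dartDegree src Finset.univ v).card ≤ r := by
  refine le_trans ?_ (h.sum_dartDegree_sub_two hr
    (Finset.univ.filter fun v => 3 ≤ dartDegree src Finset.univ v))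
  rw [Finset.card_eq_sum_ones]
  refine Finset.sum_le_sum fun v hv => ?_
  have := (Finset.mem_filter.1 hv).2
  omega

theorem card_branch_darts_le (h : IsReducedTour inv src o)
    {r : ℕ} (hr : Fintype.card X ≤ 2 * Fintype.card V + r) :
    (Finset.univ.filter fun x => 3 ≤ dartDegree src Finset.univ (src x)).card ≤ 3 * r := by
  rw [Finset.card_eq_sum_card_fiberwise (f := src)
    (t := Finset.univ.filter fun v => 3 ≤ dartDegree src Finset.univ v) (by intro x; simp)]
  have := h.sum_dartDegree_sub_two hr
    (Finset.univ.filter fun v => 3 ≤ dartDegree src Finset.univ v)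
  -- The factor 3 comes from `d ≤ 3 (d - 2)` for `d ≥ 3`.
  refine le_trans ?_ (Nat.mul_le_mul_left 3 this)
  rw [Finset.mul_sum]
  refine Finset.sum_le_sum fun v hv => ?_
  have hv := (Finset.mem_filter.1 hv).2
  have : (Finset.filter (fun x => src x = v)
      (Finset.univ.filter fun x => 3 ≤ dartDegree src Finset.univ (src x))).card ≤
      dartDegree src Finset.univ v :=
    Finset.card_le_card (Finset.filter_subset_filter _ (Finset.subset_univ _))
  omega

/-- At a suitable scale, the frequently traversed darts form a subgraph without leaves. -/
theorem exists_scale (h : IsReducedTour inv src o)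
    {r : ℕ} (hr : Fintype.card X ≤ 2 * Fintype.card V + r) (t : ℕ) :
    ∃ j ≤ r, ∀ v, dartDegree src
      (Finset.univ.filter fun x => t * (r + 2) ^ j < traversals inv o x) v ≠ 1 := by
  by_contra! hleaf
  let B : ℕ → Finset V := fun s =>
    Finset.univ.filter fun v => 3 ≤ dartDegree src Finset.univ v ∧
      ∀ x, src x = v → traversals inv o x ≤ s
  -- A leaf at scale `j` is a branch point carrying one dart above that scale, but none above the
  -- next. So each failing scale adds a new vertex to `B`, while there are at most `r` branch
  -- points.
  have hcard : ∀ j ≤ r + 1, j ≤ (B (t * (r + 2) ^ j)).card := by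
    intro j
    induction j with
    | zero => simp
    | succ j ih =>
      intro hj
      obtain ⟨v, hv⟩ := hleaf j (by omega)
      obtain ⟨h3, ⟨x, hx, hxt⟩, hall⟩ := h.of_dartDegree_eq_one hr hv
      refine (Nat.succ_le_succ (ih (by omega))).trans (Finset.card_lt_card ?_)
      have hle : t * (r + 2) ^ j ≤ t * (r + 2) ^ (j + 1) :=
        Nat.mul_le_mul_left _ (Nat.pow_le_pow_right (by omega) (by omega))
      refine (Finset.ssubset_iff_of_subset ?_).2 ⟨v, ?_, ?_⟩
      · intro w hw
        simp only [B, Finset.mem_filter, Finset.mem_univ, true_and] at hw ⊢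
        exact ⟨hw.1, fun y hy => (hw.2 y hy).trans hle⟩
      · simp only [B, Finset.mem_filter, Finset.mem_univ, true_and]
        refine ⟨h3, fun y hy => ?_⟩
        rw [pow_succ, ← mul_assoc]
        exact hall y hy
      · simp only [B, Finset.mem_filter, Finset.mem_univ, true_and, not_and, not_forall]
        exact fun _ => ⟨x, hx, by omega⟩
  have h₁ := hcard (r + 1) le_rfl
  have h₂ : (B (t * (r + 2) ^ (r + 1))).card ≤ r := by
    refine (Finset.card_le_card fun v hv => ?_).trans (h.card_branch_le hr)
    simp only [B, Finset.mem_filter, Finset.mem_univ, true_and] at hv ⊢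
    exact hv.1
  omega

/-- A tour that uses darts inside and outside of `H` leaves `H` somewhere. -/
theorem exists_leaving (h : IsReducedTour inv src o)
    {H : Finset X} (hH : ∀ x, inv x ∈ H ↔ x ∈ H) {x y : X} (hx : x ∈ H)
    (hy : y ∉ H) : ∃ i, o i ∈ H ∧ o (i + 1) ∉ H := by
  by_contra! hstay
  have hx' : ∃ i, o i ∈ H := by
    rcases h.cover x with ⟨i, rfl⟩ | ⟨i, hi⟩
    · exact ⟨i, hx⟩
    · exact ⟨i, hi ▸ (hH x).2 hx⟩
  have hy' : ∃ i, o i ∉ H := by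
    rcases h.cover y with ⟨i, rfl⟩ | ⟨i, hi⟩
    · exact ⟨i, hy⟩
    · exact ⟨i, hi ▸ fun hi' => hy ((hH y).1 hi')⟩
  obtain ⟨i, hi⟩ := hx'
  obtain ⟨j, hj⟩ := hy'
  have : ∀ n : ℕ, o (i + n) ∈ H := by
    intro n
    induction n with
    | zero => simpa using hi
    | succ n ih =>
      have := hstay _ ih
      rw [add_assoc] at this
      push_cast
      exact this
  refine hj ?_
  have := this (j - i).val
  rwa [ZMod.natCast_zmod_val, add_sub_cancel] at this

/-- A proper subgraph without leaves has smaller rank, which bounds its degrees. -/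
theorem dartDegree_subgraph_le (h : IsReducedTour inv src o)
    {r : ℕ} (hr : Fintype.card X ≤ 2 * Fintype.card V + (2 * r + 2))
    {H : Finset X} (hH : ∀ x, inv x ∈ H ↔ x ∈ H) (hleaf : ∀ v, dartDegree src H v ≠ 1)
    {y : X} (hy : y ∉ H) (v : V) : dartDegree src H v ≤ 2 * r + 2 := by
  by_cases hv : dartDegree src H v = 0
  · omega
  set W : Finset V := Finset.univ.filter fun v => dartDegree src H v ≠ 0 with hWdef
  have hW : ∀ x ∈ H, src x ∈ W := by
    intro x hx
    rw [hWdef, Finset.mem_filter]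
    exact ⟨Finset.mem_univ _, Finset.card_ne_zero_of_mem (Finset.mem_filter.2 ⟨hx, rfl⟩)⟩
  have h2 : ∀ v ∈ W, 2 ≤ dartDegree src H v := by
    intro v hv
    have h₁ := (Finset.mem_filter.1 hv).2
    have h₂ := hleaf v
    omega
  have hmain := dartDegree_add_le src H W hW h2 (v := v) (by simp [hWdef, hv])
  obtain ⟨x, hx⟩ := Finset.card_ne_zero.1 hv
  obtain ⟨i, hi, hi'⟩ := h.exists_leaving hH (Finset.mem_filter.1 hx).1 hy
  -- Where the tour leaves `H`, a vertex of `W` carries a dart outside `H`. This strict inequality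
  -- is what lowers the rank.
  have hlt : ∑ v ∈ W, dartDegree src H v < ∑ v ∈ W, dartDegree src Finset.univ v := by
    refine Finset.sum_lt_sum (fun v _ => dartDegree_mono src (Finset.subset_univ _) v)
      ⟨src (inv (o i)), hW _ ((hH _).2 hi), ?_⟩
    refine Finset.card_lt_card ((Finset.ssubset_iff_of_subset
      (Finset.filter_subset_filter _ (Finset.subset_univ _))).2 ⟨o (i + 1), ?_, ?_⟩)
    · simp [h.src_succ]
    · simp [hi']
  have hsum : ∑ v ∈ W, dartDegree src Finset.univ v +
      ∑ v ∈ Wᶜ, dartDegree src Finset.univ v = Fintype.card X := by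
    rw [Finset.sum_add_sum_compl, sum_dartDegree src Finset.univ Finset.univ (by simp),
      Finset.card_univ]
  have hcompl : Wᶜ.card • 2 ≤ ∑ v ∈ Wᶜ, dartDegree src Finset.univ v :=
    Finset.card_nsmul_le_sum _ _ _ fun v _ => h.two_le_dartDegree v
  rw [sum_dartDegree src H W hW] at hlt
  have hWc := Finset.card_add_card_compl W
  simp only [smul_eq_mul] at hcompl
  obtain ⟨a, ha⟩ := even_card_of_involutive h.involutive h.inv_ne (H := H) fun x hx => (hH x).2 hx
  omega

/-- A reduced tour covering a graph of rank at most `r + 2` with `D` edges makes, except at a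
proportion `O(1 / D)` of its steps, only transitions from a relation with out-degrees at most
`2 r + 1`. -/
theorem exists_relation (h : IsReducedTour inv src o)
    {r D : ℕ} (hr : Fintype.card X ≤ 2 * Fintype.card V + (2 * r + 2))
    (hD : 0 < D) (hX : Fintype.card X = 2 * D) :
    ∃ R : X → X → Prop, (∀ x (A : Finset X), (∀ y ∈ A, R x y) → A.card ≤ 2 * r + 1) ∧
      ∀ A : Finset (ZMod N), (∀ i ∈ A, ¬ R (o i) (o (i + 1))) →
        A.card ≤ 3 * (2 * r + 2) * (2 * r + 4) ^ (2 * r + 2) * (N / D) := by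
  obtain ⟨x₀, hx₀⟩ := h.exists_traversals_le hD hX
  obtain ⟨j, hj, hleaf⟩ := h.exists_scale hr (N / D)
  set t := N / D * (2 * r + 2 + 2) ^ j with ht
  have htle : t ≤ (2 * r + 4) ^ (2 * r + 2) * (N / D) := by
    rw [mul_comm]
    exact Nat.mul_le_mul_left _ (Nat.pow_le_pow_right (by omega) hj)
  set H : Finset X := Finset.univ.filter fun x => t < traversals inv o x with hHdef
  have hH : ∀ x, inv x ∈ H ↔ x ∈ H := by
    intro x
    simp [hHdef, h.traversals_inv]
  have hxH : x₀ ∉ H := by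
    simp only [hHdef, Finset.mem_filter, Finset.mem_univ, true_and, not_lt]
    refine hx₀.trans ?_
    rw [ht]
    exact Nat.le_mul_of_pos_right _ (by positivity)
  have hdeg := h.dartDegree_subgraph_le hr hH hleaf hxH
  -- A reduced transition is allowed if it passes a vertex of degree at most two, where it is
  -- forced, or if it stays among the frequent darts `H`, whose degrees are at most `2 r + 2`.
  refine ⟨fun x y => src y = src (inv x) ∧ y ≠ inv x ∧
    (dartDegree src Finset.univ (src (inv x)) ≤ 2 ∨ (x ∈ H ∧ y ∈ H)), ?_, ?_⟩
  · intro x A hA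
    by_cases h2 : dartDegree src Finset.univ (src (inv x)) ≤ 2
    · have : A ⊆ (Finset.univ.filter fun y => src y = src (inv x)).erase (inv x) := by
        intro y hy
        simp [(hA y hy).1, (hA y hy).2.1]
      have hc := Finset.card_le_card this
      rw [Finset.card_erase_of_mem (by simp)] at hc
      unfold dartDegree at h2
      omega
    · rcases A.eq_empty_or_nonempty with rfl | ⟨y₀, hy₀⟩
      · simp
      have hx : x ∈ H := ((hA y₀ hy₀).2.2.resolve_left h2).1
      have : A ⊆ (H.filter fun y => src y = src (inv x)).erase (inv x) := by
        intro y hy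
        simp [(hA y hy).1, (hA y hy).2.1, ((hA y hy).2.2.resolve_left h2).2]
      have hc := Finset.card_le_card this
      rw [Finset.card_erase_of_mem (by simp [(hH x).2 hx])] at hc
      have := hdeg (src (inv x))
      unfold dartDegree at this
      omega
  · intro A hA
    set Q : Finset X := Finset.univ.filter fun x =>
      3 ≤ dartDegree src Finset.univ (src x) ∧ x ∉ H with hQ
    -- An exceptional step passes a branch point and uses a rare dart on its way in or out. There
    -- are at most `3 (2 r + 2)` such darts, each traversed at most `t` times.
    have hsub : A ⊆ (Finset.univ.filter fun i => inv (o i) ∈ Q) ∪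
        (Finset.univ.filter fun i => o (i + 1) ∈ Q) := by
      intro i hi
      have := hA i hi
      simp only [h.src_succ, h.reduced, true_and, ne_eq, not_false_eq_true, not_or, not_le,
        not_and_or] at this
      simp only [hQ, Finset.mem_union, Finset.mem_filter, Finset.mem_univ, true_and, hH,
        h.src_succ]
      have h3 : 3 ≤ dartDegree src Finset.univ (src (inv (o i))) := this.1
      exact this.2.imp (fun hh => ⟨h3, hh⟩) fun hh => ⟨h3, hh⟩
    have h₁ : (Finset.univ.filter fun i => o (i + 1) ∈ Q).card ≤
        (Finset.univ.filter fun i => o i ∈ Q).card :=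
      Finset.card_le_card_of_injOn (fun i => i + 1) (fun i hi => by simpa using hi)
        (by intro; simp)
    have h₂ := h.sum_traversals Q
    have h₃ : ∑ x ∈ Q, traversals inv o x ≤ Q.card • t := by
      refine Finset.sum_le_card_nsmul _ _ _ fun x hx => ?_
      have := (Finset.mem_filter.1 hx).2.2
      simpa [hHdef] using this
    have h₄ : Q.card ≤ 3 * (2 * r + 2) := by
      refine (Finset.card_le_card fun x hx => ?_).trans (h.card_branch_darts_le hr)
      simp only [hQ, Finset.mem_filter, Finset.mem_univ, true_and] at hx ⊢
      exact hx.1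
    have h₅ := (Finset.card_le_card hsub).trans (Finset.card_union_le _ _)
    calc A.card ≤ Q.card * t := by rw [← smul_eq_mul]; omega
      _ ≤ 3 * (2 * r + 2) * ((2 * r + 4) ^ (2 * r + 2) * (N / D)) := Nat.mul_le_mul h₄ htle
      _ = _ := by ring

end IsReducedTour

end Tours

/-! ### Counting walks with few exceptional transitions. -/

section Walks

/-- The words of length `n + 1` read along walks in `A` that make at most `b` transitions outside
of some relation with out-degrees at most `m`. -/
def walkWords (A β : Type*) (m b n : ℕ) : Set (List β) :=
  {L | ∃ (lab : A → β) (R : A → A → Prop) (f : Fin (n + 1) → A), L = List.ofFn (lab ∘ f) ∧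
    (∀ x (Y : Finset A), (∀ y ∈ Y, R x y) → Y.card ≤ m) ∧
    ∀ Y : Finset (Fin n), (∀ i ∈ Y, ¬ R (f i.castSucc) (f i.succ)) → Y.card ≤ b}

/-- The sum of all entries of the `n`-th power of a nonnegative matrix, bounded by its row sums. -/
theorem sum_prod_transitions_le {A : Type*} [Fintype A] {M : A → A → ℝ} (hM : ∀ a b, 0 ≤ M a b)
    {Λ : ℝ} (hΛ : ∀ a, ∑ b, M a b ≤ Λ) (hΛ0 : 0 ≤ Λ) (n : ℕ) :
    ∑ f : Fin (n + 1) → A, ∏ i : Fin n, M (f i.castSucc) (f i.succ) ≤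
      Fintype.card A * Λ ^ n := by
  induction n with
  | zero => simp
  | succ n ih =>
    rw [← (Fin.snocEquiv fun _ : Fin (n + 2) => A).sum_comp, Fintype.sum_prod_type_right]
    calc ∑ g : Fin (n + 1) → A, ∑ a : A, ∏ i : Fin (n + 1),
          M (Fin.snocEquiv (fun _ => A) (a, g) i.castSucc)
            (Fin.snocEquiv (fun _ => A) (a, g) i.succ)
        = ∑ g : Fin (n + 1) → A, ∑ a : A,
            (∏ i : Fin n, M (g i.castSucc) (g i.succ)) * M (g (Fin.last n)) a := by
          refine Finset.sum_congr rfl fun g _ => Finset.sum_congr rfl fun a _ => ?_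
          rw [Fin.prod_univ_castSucc]
          congr 1
          · refine Finset.prod_congr rfl fun i _ => ?_
            simp only [Fin.snocEquiv, Equiv.coe_fn_mk, Fin.succ_castSucc, Fin.snoc_castSucc]
          · simp only [Fin.snocEquiv, Equiv.coe_fn_mk, Fin.succ_last, Fin.snoc_castSucc,
              Fin.snoc_last]
      _ ≤ ∑ g : Fin (n + 1) → A, (∏ i : Fin n, M (g i.castSucc) (g i.succ)) * Λ := by
          refine Finset.sum_le_sum fun g _ => ?_
          rw [← Finset.mul_sum]
          exact mul_le_mul_of_nonneg_left (hΛ _) (Finset.prod_nonneg fun i _ => hM _ _)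
      _ ≤ Fintype.card A * Λ ^ n * Λ := by
          rw [← Finset.sum_mul]
          exact mul_le_mul_of_nonneg_right ih hΛ0
      _ = Fintype.card A * Λ ^ (n + 1) := by ring

open Classical in
-- Transitions in `R` get weight `1` and all others weight `x`. A counted walk then weighs at least
-- `x ^ b`, and each row sums to at most `m + |A| x`.
theorem card_walks_mul_pow_le {A : Type*} [Fintype A] {R : A → A → Prop} {m : ℕ}
    (hR : ∀ x (Y : Finset A), (∀ y ∈ Y, R x y) → Y.card ≤ m) {x : ℝ} (hx : 0 < x) (hx1 : x ≤ 1)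
    (b n : ℕ) :
    ((Finset.univ.filter fun f : Fin (n + 1) → A =>
      (Finset.univ.filter fun i : Fin n => ¬ R (f i.castSucc) (f i.succ)).card ≤ b).card : ℝ) *
        x ^ b ≤ Fintype.card A * (m + Fintype.card A * x) ^ n := by
  have h := sum_prod_transitions_le (M := fun a b => if R a b then 1 else x)
    (fun a b => by split_ifs <;> positivity) (Λ := m + Fintype.card A * x)
    (fun a => by
      calc ∑ b, (if R a b then (1 : ℝ) else x) ≤ ∑ b, ((if R a b then (1 : ℝ) else 0) + x) := by
            refine Finset.sum_le_sum fun b _ => ?_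
            split_ifs <;> linarith
        _ = ((Finset.univ.filter fun b => R a b).card : ℝ) + Fintype.card A * x := by
            rw [Finset.sum_add_distrib, Finset.sum_boole]
            simp
        _ ≤ _ := by
            gcongr
            exact_mod_cast hR a _ fun y hy => (Finset.mem_filter.1 hy).2)
    (by positivity) n
  refine le_trans ?_ h
  rw [← nsmul_eq_mul]
  refine (Finset.card_nsmul_le_sum _ (fun f : Fin (n + 1) → A => ∏ i : Fin n,
      if R (f i.castSucc) (f i.succ) then (1 : ℝ) else x) _ fun f hf => ?_).trans
    (Finset.sum_le_sum_of_subset_of_nonneg (Finset.subset_univ _) fun f _ _ =>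
      Finset.prod_nonneg fun i _ => by split_ifs <;> positivity)
  rw [Finset.prod_ite, Finset.prod_const_one, one_mul, Finset.prod_const]
  exact pow_le_pow_of_le_one hx.le hx1 (Finset.mem_filter.1 hf).2

open Classical in
-- The labelling and the relation vary with the word, but on a fixed finite `A` there are finitely
-- many, which costs only a factor independent of `n`.
theorem ncard_walkWords_mul_pow_le (A β : Type*) [Fintype A] [Fintype β] {x : ℝ} (hx : 0 < x)
    (hx1 : x ≤ 1) (m b n : ℕ) :
    (walkWords A β m b n).Finite ∧ ((walkWords A β m b n).ncard : ℝ) * x ^ b ≤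
      Nat.card ((A → β) × (A → A → Prop)) *
        (Fintype.card A * (m + Fintype.card A * x) ^ n) := by
  let T : (A → β) × (A → A → Prop) → Finset (List β) := fun q =>
    if ∀ x (Y : Finset A), (∀ y ∈ Y, q.2 x y) → Y.card ≤ m then
      (Finset.univ.filter fun f : Fin (n + 1) → A =>
        (Finset.univ.filter fun i : Fin n => ¬ q.2 (f i.castSucc) (f i.succ)).card ≤ b).image
          fun f => List.ofFn (q.1 ∘ f)
    else ∅
  have hsub : walkWords A β m b n ⊆ ↑(Finset.univ.biUnion T) := by
    rintro L ⟨lab, R, f, rfl, hR, hb⟩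
    simp only [Finset.coe_biUnion, Set.mem_iUnion]
    refine ⟨(lab, R), by simp, ?_⟩
    simp only [T]
    rw [if_pos hR]
    refine Finset.mem_coe.2 (Finset.mem_image.2 ⟨f, Finset.mem_filter.2 ⟨Finset.mem_univ _, ?_⟩,
      rfl⟩)
    exact hb _ fun i hi => (Finset.mem_filter.1 hi).2
  refine ⟨(Finset.finite_toSet _).subset hsub, ?_⟩
  have h₁ : (walkWords A β m b n).ncard ≤ ∑ q, (T q).card := by
    refine (Set.ncard_le_ncard hsub (Finset.finite_toSet _)).trans ?_
    rw [Set.ncard_coe_finset]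
    exact Finset.card_biUnion_le
  calc ((walkWords A β m b n).ncard : ℝ) * x ^ b ≤ (∑ q, ((T q).card : ℝ)) * x ^ b := by
        gcongr
        exact_mod_cast h₁
    _ = ∑ q, ((T q).card : ℝ) * x ^ b := Finset.sum_mul _ _ _
    _ ≤ ∑ _q : (A → β) × (A → A → Prop), Fintype.card A * (m + Fintype.card A * x) ^ n := by
        refine Finset.sum_le_sum fun q _ => ?_
        simp only [T]
        split_ifs with hq
        · refine le_trans ?_ (card_walks_mul_pow_le hq hx hx1 b n)
          gcongr
          exact Finset.card_image_le
        · simp only [Finset.card_empty, Nat.cast_zero, zero_mul]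
          positivity
    _ = _ := by
        rw [Finset.sum_const, Finset.card_univ, nsmul_eq_mul, Nat.card_eq_fintype_card]

theorem mem_walkWords_of_embedding {X A β : Type*} (φ : X ↪ A) (lab : X → β)
    (R : X → X → Prop) {m b n : ℕ} (f : Fin (n + 1) → X)
    (hR : ∀ x (Y : Finset X), (∀ y ∈ Y, R x y) → Y.card ≤ m)
    (hb : ∀ Y : Finset (Fin n), (∀ i ∈ Y, ¬ R (f i.castSucc) (f i.succ)) → Y.card ≤ b) :
    List.ofFn (lab ∘ f) ∈ walkWords A β m b n := by
  classical
  -- The label off the image of `φ` is arbitrary, since the walk never goes there.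
  refine ⟨Function.extend φ lab fun _ => lab (f 0),
    fun a a' => ∃ x x', φ x = a ∧ φ x' = a' ∧ R x x', φ ∘ f, ?_, ?_, ?_⟩
  · congr 1
    funext i
    simp [φ.injective.extend_apply]
  · intro a Y hY
    rcases Y.eq_empty_or_nonempty with rfl | ⟨y₀, hy₀⟩
    · simp
    obtain ⟨x, -, rfl, -, -⟩ := hY y₀ hy₀
    have hYi : Y ⊆ (Y.preimage φ φ.injective.injOn).image φ := by
      intro y hy
      obtain ⟨-, x', -, rfl, -⟩ := hY y hy
      exact Finset.mem_image_of_mem _ (Finset.mem_preimage.2 hy)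
    refine (Finset.card_le_card hYi).trans (Finset.card_image_le.trans (hR x _ fun y hy => ?_))
    obtain ⟨x₁, x₂, h₁, h₂, h₃⟩ := hY _ (Finset.mem_preimage.1 hy)
    rwa [φ.injective h₁, φ.injective h₂] at h₃
  · intro Y hY
    refine hb Y fun i hi hRi => hY i hi ⟨_, _, rfl, rfl, hRi⟩

end Walks

/-! ### Closed paths as reduced tours of their traces. -/

section TracedTours

variable {α : Type*} [DecidableEq α]

/-- The origin of a dart of a labelled graph: an edge together with a direction. -/
def dartSource (x : (ℕ × α × ℕ) × Bool) : ℕ := if x.2 then x.1.1 else x.1.2.2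

theorem dartSource_orientedEdge (u v : ℕ) (l : α × Bool) :
    dartSource (orientedEdge u l v, l.2) = u ∧ dartSource (orientedEdge u l v, !l.2) = v := by
  rcases l with ⟨s, _ | _⟩ <;> simp [dartSource, orientedEdge]

theorem orientedEdge_label (u v : ℕ) (l : α × Bool) : (orientedEdge u l v).2.1 = l.1 := by
  rcases l with ⟨s, _ | _⟩ <;> simp [orientedEdge]

variable {N : ℕ} [NeZero N] (ℓ : ZMod N → α × Bool) (p : ZMod N → ℕ)

theorem mem_tracedEdges (i : ZMod N) :
    orientedEdge (p i) (ℓ i) (p (i + 1)) ∈ tracedEdges ℓ p :=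
  Finset.mem_image_of_mem _ (Finset.mem_univ i)

theorem mem_tracedVertices (i : ZMod N) : p i ∈ tracedVertices p :=
  Finset.mem_image_of_mem _ (Finset.mem_univ i)

theorem dartSource_mem (x : tracedEdges ℓ p × Bool) :
    dartSource (x.1.1, x.2) ∈ tracedVertices p := by
  obtain ⟨⟨e, he⟩, c⟩ := x
  obtain ⟨i, -, rfl⟩ := Finset.mem_image.1 he
  have h := dartSource_orientedEdge (p i) (p (i + 1)) (ℓ i)
  by_cases hc : c = (ℓ i).2
  · subst hc
    simp only [h.1]
    exact mem_tracedVertices p i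
  · obtain rfl : c = !(ℓ i).2 := Bool.eq_not_of_ne hc
    simp only [h.2]
    exact mem_tracedVertices p (i + 1)

/-- A cyclically reduced closed path is a reduced tour of the graph it traces. -/
theorem isReducedTour_traced (hred : ∀ i, ℓ (i + 1) ≠ ((ℓ i).1, !(ℓ i).2)) :
    IsReducedTour (X := tracedEdges ℓ p × Bool) (V := tracedVertices p)
      (fun x => (x.1, !x.2)) (fun x => ⟨dartSource (x.1.1, x.2), dartSource_mem ℓ p x⟩)
      (fun i => (⟨_, mem_tracedEdges ℓ p i⟩, (ℓ i).2)) where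
  involutive := fun x => by simp
  inv_ne := fun x hx => by
    have := congrArg Prod.snd hx
    simp at this
  surjective := by
    rintro ⟨v, hv⟩
    obtain ⟨i, -, rfl⟩ := Finset.mem_image.1 hv
    exact ⟨(⟨_, mem_tracedEdges ℓ p i⟩, (ℓ i).2),
      Subtype.ext (dartSource_orientedEdge (p i) (p (i + 1)) (ℓ i)).1⟩
  src_succ := fun i => Subtype.ext <|
    (dartSource_orientedEdge _ _ (ℓ (i + 1))).1.trans (dartSource_orientedEdge _ _ (ℓ i)).2.symm
  reduced := by
    intro i hi
    have h₂ := congrArg Prod.snd hi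
    refine hred i (Prod.ext ?_ h₂)
    have := congrArg (fun x : tracedEdges ℓ p × Bool => x.1.1.2.1) hi
    simpa only [orientedEdge_label] using this
  cover := by
    rintro ⟨⟨e, he⟩, c⟩
    obtain ⟨i, -, rfl⟩ := Finset.mem_image.1 he
    by_cases hc : (ℓ i).2 = c
    · exact Or.inl ⟨i, Prod.ext rfl hc⟩
    · refine Or.inr ⟨i, Prod.ext rfl ?_⟩
      revert hc
      cases (ℓ i).2 <;> cases c <;> simp

end TracedTours

/-! ### Coding cyclically reduced words as walks on `2 D` states. -/

section Coding

variable {α : Type*} [DecidableEq α]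

theorem ofFn_mem_walkWords {n r D : ℕ} (hD : 0 < D) (ℓ : ZMod (n + 1) → α × Bool)
    (hred : ∀ i, ℓ (i + 1) ≠ ((ℓ i).1, !(ℓ i).2)) (p : ZMod (n + 1) → ℕ)
    (hp : ((tracedEdges ℓ p).card ≤ D ∧
        (tracedEdges ℓ p).card + 2 ≤ (tracedVertices p).card + (r + 2)) ∨
      ((tracedEdges ℓ p).card = D ∧
        (tracedEdges ℓ p).card + 1 ≤ (tracedVertices p).card + (r + 2))) :
    List.ofFn (n := n + 1) ℓ ∈ walkWords (Fin (2 * D)) (α × Bool) (2 * r + 1)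
      (3 * (2 * r + 2) * (2 * r + 4) ^ (2 * r + 2) * ((n + 1) / D)) n := by
  have htour := isReducedTour_traced ℓ p hred
  have hX : Fintype.card (tracedEdges ℓ p × Bool) = 2 * (tracedEdges ℓ p).card := by
    simp [mul_comm]
  have hV : Fintype.card (tracedVertices p) = (tracedVertices p).card := by simp
  have hle : Fintype.card (tracedEdges ℓ p × Bool) ≤ Fintype.card (Fin (2 * D)) := by
    rw [hX, Fintype.card_fin]
    rcases hp with hp | hp <;> omega
  obtain ⟨φ⟩ := Function.Embedding.nonempty_of_card_le hle
  have hlab : (ℓ : Fin (n + 1) → α × Bool) =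
      (fun x : tracedEdges ℓ p × Bool => (x.1.1.2.1, x.2)) ∘
        fun i : ZMod (n + 1) => (⟨_, mem_tracedEdges ℓ p i⟩, (ℓ i).2) := by
    funext i
    exact Prod.ext (orientedEdge_label _ _ _).symm rfl
  have hsucc : ∀ i : Fin n, ((i.castSucc : Fin (n + 1)) : ZMod (n + 1)) + 1 = i.succ :=
    fun i => Fin.coeSucc_eq_succ
  rw [hlab]
  rcases hp with hp | hp
  -- In rank at most `r + 1` every reduced continuation is allowed, so no step is exceptional.
  · refine mem_walkWords_of_embedding φ _ (fun x y =>
        (⟨dartSource (y.1.1, y.2), dartSource_mem ℓ p y⟩ : tracedVertices p) =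
          ⟨dartSource (x.1.1, !x.2), dartSource_mem ℓ p (x.1, !x.2)⟩ ∧ y ≠ (x.1, !x.2)) _
      (fun x Y hY => (Finset.card_le_card fun y hy => ?_).trans
        (htour.card_continuations_le (r := r) (by omega) x)) fun Y hY => ?_
    · exact Finset.mem_filter.2 ⟨Finset.mem_univ _, hY y hy⟩
    · rcases Y.eq_empty_or_nonempty with rfl | ⟨i, hi⟩
      · simp
      · refine absurd ⟨?_, ?_⟩ (hY i hi)
        · rw [← hsucc]
          exact htour.src_succ _
        · rw [← hsucc]
          exact htour.reduced _
  · obtain ⟨R, hR, hbad⟩ := htour.exists_relation (r := r) (D := D) (by omega) hD (by omega)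
    refine mem_walkWords_of_embedding φ _ R _ hR fun Y hY => ?_
    rw [← Finset.card_map Fin.castSuccEmb]
    refine hbad (Y.map Fin.castSuccEmb) fun i hi => ?_
    obtain ⟨j, hj, rfl⟩ := Finset.mem_map.1 hi
    have := hY j hj
    rw [← hsucc] at this
    exact this

theorem cyclic_ne_inv {L : List (α × Bool)} (hL : FreeGroup.IsCyclicallyReduced L)
    [NeZero L.length] (i : ZMod L.length) :
    L[(i + 1).val]'(ZMod.val_lt _) ≠
      ((L[i.val]'(ZMod.val_lt _)).1, !(L[i.val]'(ZMod.val_lt _)).2) := by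
  suffices h : (L[i.val]'(ZMod.val_lt _)).1 = (L[(i + 1).val]'(ZMod.val_lt _)).1 →
      (L[i.val]'(ZMod.val_lt _)).2 = (L[(i + 1).val]'(ZMod.val_lt _)).2 by
    intro heq
    rw [heq] at h
    simp at h
  rcases lt_or_eq_of_le (Nat.succ_le_of_lt (ZMod.val_lt i)) with hlt | heq
  · have hv : (i + 1).val = i.val + 1 := by
      rw [ZMod.val_add, ZMod.val_one_eq_one_mod, Nat.add_mod_mod, Nat.mod_eq_of_lt hlt]
    simp only [hv]
    exact List.isChain_iff_getElem.1 hL.1 i.val hlt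
  · have hv : (i + 1).val = 0 := by
      rw [ZMod.val_add, ZMod.val_one_eq_one_mod, Nat.add_mod_mod, ← Nat.succ_eq_add_one, heq,
        Nat.mod_self]
    simp only [hv]
    refine hL.2 _ ?_ _ ?_
    · rw [List.getLast?_eq_getElem?, show L.length - 1 = i.val by omega]
      simp
    · rw [List.head?_eq_getElem?]
      simp

/-- Nonempty cyclically reduced words in a subgroup generated by all but one of `k` elements that
generate a free group of rank `k`. -/
def properWords (α : Type*) [Fintype α] (n : ℕ) : Set (List (α × Bool)) :=
  {L | L.length = n ∧ FreeGroup.IsCyclicallyReduced L ∧ ∃ (B : List (FreeGroup α))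
    (b : FreeGroup α), B.length + 1 = Fintype.card α ∧
      Subgroup.closure {g | g ∈ b :: B} = ⊤ ∧ FreeGroup.mk L ∈ Subgroup.closure {g | g ∈ B}}

theorem properWords_subset_walkWords [Fintype α] {r D n : ℕ} (hr : Fintype.card α = r + 2)
    (hD : r + 2 ≤ D) :
    properWords α (n + 1) ⊆ walkWords (Fin (2 * D)) (α × Bool) (2 * r + 1)
      (3 * (2 * r + 2) * (2 * r + 4) ^ (2 * r + 2) * ((n + 1) / D)) n := by
  rintro L ⟨hlen, hcyc, B, b, hB, htop, hmem⟩
  have : NeZero L.length := ⟨by omega⟩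
  obtain ⟨p, hp⟩ := exists_closed_path B b hB htop hcyc.1 hmem (D := D) (by omega)
  rw [hr] at hp
  have hred := cyclic_ne_inv hcyc
  have main : ∀ (N : ℕ) [NeZero N] (hN : N = n + 1) (ℓ : ZMod N → α × Bool)
      (_ : ∀ i, ℓ (i + 1) ≠ ((ℓ i).1, !(ℓ i).2)) (p : ZMod N → ℕ)
      (_ : ((tracedEdges ℓ p).card ≤ D ∧
        (tracedEdges ℓ p).card + 2 ≤ (tracedVertices p).card + (r + 2)) ∨
      ((tracedEdges ℓ p).card = D ∧
        (tracedEdges ℓ p).card + 1 ≤ (tracedVertices p).card + (r + 2))),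
      List.ofFn (fun i : Fin N => ℓ (i.val : ZMod N)) ∈
        walkWords (Fin (2 * D)) (α × Bool) (2 * r + 1)
      (3 * (2 * r + 2) * (2 * r + 4) ^ (2 * r + 2) * ((n + 1) / D)) n := by
    rintro N _ rfl ℓ hℓ p hp
    have h := ofFn_mem_walkWords (by omega) ℓ hℓ p hp
    convert h using 1
    exact congrArg List.ofFn (funext fun i => congrArg ℓ (Fin.cast_val_eq_self i))
  have h := main _ hlen _ hred p hp
  convert h using 1
  conv_lhs => rw [← List.ofFn_getElem (xs := L)]
  congr 1
  funext i
  simp [ZMod.val_cast_of_lt i.isLt]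

end Coding

/-! ### Growth of cyclically reduced words. -/

section UpperBound

/-- The price of the exceptional steps, `(4 D / ε) ^ (c / D)` per letter, tends to `1` as `D` grows.
-/
theorem exists_scale_rpow_le {m ε c : ℝ} (hε : 0 < ε) (k : ℕ) :
    ∃ D : ℕ, k ≤ D ∧ 0 < D ∧ ε ≤ 4 * D ∧
      (m + ε / 2) * (4 * D / ε) ^ (c / D) ≤ m + ε := by
  have h₁ : Filter.Tendsto (fun D : ℕ => 4 * (D : ℝ) / ε) Filter.atTop Filter.atTop :=
    (tendsto_natCast_atTop_atTop.const_mul_atTop (by norm_num)).atTop_div_const hε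
  have h₂ := (tendsto_rpow_div_mul_add c (ε / 4) 0 (by positivity)).comp h₁
  have h₃ : Filter.Tendsto (fun D : ℕ => (m + ε / 2) * (4 * (D : ℝ) / ε) ^ (c / D))
      Filter.atTop (nhds ((m + ε / 2) * 1)) := by
    refine Filter.Tendsto.const_mul _ (h₂.congr fun D => ?_)
    simp only [Function.comp_apply]
    congr 2
    field_simp
    ring
  have h₄ := h₃.eventually_lt_const (u := m + ε) (by linarith)
  obtain ⟨D, hD⟩ := (h₄.and ((Filter.eventually_ge_atTop k).and
    ((Filter.eventually_gt_atTop 0).and (h₁.eventually_ge_atTop 1)))).exists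
  refine ⟨D, hD.2.1, hD.2.2.1, ?_, hD.1.le⟩
  have := hD.2.2.2
  rwa [le_div_iff₀ hε, one_mul] at this

theorem exists_ncard_properWords_le {α : Type*} [DecidableEq α] [Fintype α] {r : ℕ}
    (hr : Fintype.card α = r + 2) {ε : ℝ} (hε : 0 < ε) :
    (∀ n, (properWords α (n + 1)).Finite) ∧ ∃ K : ℝ, 0 ≤ K ∧ ∀ n,
      ((properWords α (n + 1)).ncard : ℝ) ≤ K * (2 * r + 1 + ε) ^ (n + 1) := by
  obtain ⟨c, hc⟩ : ∃ c, c = 3 * (2 * r + 2) * (2 * r + 4) ^ (2 * r + 2) := ⟨_, rfl⟩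
  obtain ⟨D, hkD, hD, hεD, hle⟩ :=
    exists_scale_rpow_le (m := 2 * r + 1) (c := c) hε (r + 2)
  have hD' : (0 : ℝ) < D := by exact_mod_cast hD
  have hsub : ∀ n, properWords α (n + 1) ⊆
      walkWords (Fin (2 * D)) (α × Bool) (2 * r + 1) (c * ((n + 1) / D)) n := fun n => by
    rw [hc]
    exact properWords_subset_walkWords hr hkD
  -- With `2 D` states this makes `|A| x = ε / 2`, leaving the other half of `ε` for the factor `x⁻¹
  -- ^ b`.
  obtain ⟨x, hx⟩ : ∃ x : ℝ, x = ε / (4 * D) := ⟨_, rfl⟩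
  have hx0 : 0 < x := by rw [hx]; positivity
  have hx1 : x ≤ 1 := by rw [hx, div_le_one (by positivity)]; exact hεD
  have hfin := fun n => (ncard_walkWords_mul_pow_le (Fin (2 * D)) (α × Bool) hx0 hx1 (2 * r + 1)
    (c * ((n + 1) / D)) n)
  refine ⟨fun n => (hfin n).1.subset (hsub n), ?_⟩
  obtain ⟨K, hK⟩ : ∃ K : ℝ, K =
    Nat.card ((Fin (2 * D) → α × Bool) × (Fin (2 * D) → Fin (2 * D) → Prop)) * (2 * D) :=
    ⟨_, rfl⟩
  have hK0 : 0 ≤ K := by rw [hK]; positivity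
  refine ⟨K, hK0, fun n => ?_⟩
  have h₁ := (hfin n).2
  have h₂ : (2 * r + 1 + ε / 2 : ℝ) = ((2 * r + 1 : ℕ) : ℝ) + Fintype.card (Fin (2 * D)) * x := by
    rw [hx, Fintype.card_fin]
    push_cast
    field_simp
    ring
  rw [← h₂, Fintype.card_fin, ← mul_assoc] at h₁
  simp only [Nat.cast_mul, Nat.cast_ofNat] at h₁
  rw [← hK] at h₁
  have h₃ : ((properWords α (n + 1)).ncard : ℝ) ≤
      (walkWords (Fin (2 * D)) (α × Bool) (2 * r + 1) (c * ((n + 1) / D)) n).ncard := by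
    exact_mod_cast Set.ncard_le_ncard (hsub n) (hfin n).1
  have hinv : x⁻¹ = 4 * D / ε := by rw [hx, inv_div]
  have h1inv : 1 ≤ x⁻¹ := (one_le_inv₀ hx0).2 hx1
  have h₄ : x⁻¹ ^ (c * ((n + 1) / D)) ≤ ((4 * D / ε) ^ ((c : ℝ) / D)) ^ (n + 1) := by
    rw [← Real.rpow_natCast, ← Real.rpow_natCast, ← hinv, ← Real.rpow_mul (by positivity)]
    refine Real.rpow_le_rpow_of_exponent_le h1inv ?_
    have h₅ : (((n + 1) / D : ℕ) : ℝ) ≤ ((n + 1 : ℕ) : ℝ) / D := Nat.cast_div_le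
    push_cast at h₅ ⊢
    calc (c : ℝ) * (((n + 1) / D : ℕ) : ℝ) ≤ c * (((n : ℝ) + 1) / D) := by gcongr
      _ = c / D * (n + 1) := by ring
  calc ((properWords α (n + 1)).ncard : ℝ)
      ≤ (walkWords (Fin (2 * D)) (α × Bool) (2 * r + 1) (c * ((n + 1) / D)) n).ncard := h₃
    _ = (walkWords (Fin (2 * D)) (α × Bool) (2 * r + 1) (c * ((n + 1) / D)) n).ncard *
          x ^ (c * ((n + 1) / D)) * x⁻¹ ^ (c * ((n + 1) / D)) := by
        rw [mul_assoc, ← mul_pow, mul_inv_cancel₀ hx0.ne', one_pow, mul_one]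
    _ ≤ (K * (2 * r + 1 + ε / 2) ^ n) * ((4 * D / ε) ^ ((c : ℝ) / D)) ^ (n + 1) := by
        gcongr
    _ ≤ (K * (2 * r + 1 + ε / 2) ^ (n + 1)) * ((4 * D / ε) ^ ((c : ℝ) / D)) ^ (n + 1) := by
        gcongr
        · have : (0 : ℝ) ≤ r := by positivity
          linarith
        · omega
    _ = K * ((2 * r + 1 + ε / 2) * (4 * D / ε) ^ ((c : ℝ) / D)) ^ (n + 1) := by
        rw [mul_pow]; ring
    _ ≤ K * (2 * r + 1 + ε) ^ (n + 1) := by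
        gcongr

end UpperBound

/-! ### From free factors to generators, and from cyclically reduced words to all words. -/

section FreeFactors

theorem FreeGroupBasis.closure_range_eq_top {ι G : Type*} [Group G] (b : FreeGroupBasis ι G) :
    Subgroup.closure (Set.range b) = ⊤ := by
  have h : Set.range b = b.repr.symm.toMonoidHom '' Set.range FreeGroup.of := by
    rw [← Set.range_comp]
    rfl
  rw [h, ← MonoidHom.map_closure, FreeGroup.closure_range_of, ← MonoidHom.range_eq_map,
    MonoidHom.range_eq_top]
  exact b.repr.symm.surjective

theorem FreeGroupBasis.le_closure {ι G : Type*} [Group G] {H : Subgroup G}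
    (b : FreeGroupBasis ι H) : H ≤ Subgroup.closure (Set.range fun i => (b i : G)) := by
  have h : Set.range (fun i => (b i : G)) = H.subtype '' Set.range b := by
    rw [← Set.range_comp]
    rfl
  rw [h, ← MonoidHom.map_closure, b.closure_range_eq_top, ← MonoidHom.range_eq_map,
    Subgroup.range_subtype]

theorem finite_of_finite_fun {ι M : Type*} [Nontrivial M] [Finite (ι → M)] : Finite ι := by
  classical
  obtain ⟨x, y, hxy⟩ := exists_pair_ne M
  refine Finite.of_injective (fun i : ι => Function.update (fun _ => x) i y) fun i j hij => ?_
  by_contra hne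
  have := congrFun hij i
  simp [Function.update_of_ne hne] at this
  exact hxy this.symm

/-- The bases of the two factors of a free product decomposition of a free group have, together, as
many elements as the rank. -/
theorem card_sum_basis_eq {α : Type*} [Fintype α] {H K : Subgroup (FreeGroup α)}
    (hb : Function.Bijective (Monoid.Coprod.lift H.subtype K.subtype)) {ι κ : Type*}
    (bH : FreeGroupBasis ι H) (bK : FreeGroupBasis κ K) :
    Finite (ι ⊕ κ) ∧ Nat.card (ι ⊕ κ) = Fintype.card α := by
  let M := Multiplicative (ZMod 2)
  let E := MulEquiv.ofBijective (Monoid.Coprod.lift H.subtype K.subtype) hb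
  -- Ranks are compared by counting homomorphisms to the group of order two.
  let Φ : (ι ⊕ κ → M) ≃ (α → M) :=
    (Equiv.sumArrowEquivProdArrow ι κ M).trans <|
      (Equiv.prodCongr bH.lift bK.lift).trans <|
        Monoid.Coprod.liftEquiv.trans <|
          (E.monoidHomCongrLeftEquiv (N := M)).trans FreeGroup.lift.symm
  have : Finite M := inferInstanceAs (Finite (ZMod 2))
  have : Nontrivial M := inferInstanceAs (Nontrivial (ZMod 2))
  have : Finite (ι ⊕ κ → M) := Finite.of_equiv _ Φ.symm
  have hfin : Finite (ι ⊕ κ) := finite_of_finite_fun (M := M)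
  refine ⟨hfin, ?_⟩
  have hM : Nat.card M = 2 := (Nat.card_zmod 2)
  have hcard := Nat.card_congr Φ
  rw [Nat.card_fun, Nat.card_fun, hM, Nat.card_eq_fintype_card (α := α)] at hcard
  exact Nat.pow_right_injective le_rfl hcard

theorem IsFreeFactor.exists_generators {α : Type} [Fintype α] {H : Subgroup (FreeGroup α)}
    (hH : IsFreeFactor H) (hne : H ≠ ⊤) :
    ∃ (B : List (FreeGroup α)) (b : FreeGroup α), B.length + 1 = Fintype.card α ∧
      Subgroup.closure {g | g ∈ b :: B} = ⊤ ∧ H ≤ Subgroup.closure {g | g ∈ B} := by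
  classical
  obtain ⟨K, hb⟩ := hH
  obtain ⟨ι, ⟨bH⟩⟩ := (inferInstance : IsFreeGroup H).nonempty_basis
  obtain ⟨κ, ⟨bK⟩⟩ := (inferInstance : IsFreeGroup K).nonempty_basis
  obtain ⟨hfin, hcard⟩ := card_sum_basis_eq hb bH bK
  have : Finite ι := Finite.of_injective (Sum.inl : ι → ι ⊕ κ) Sum.inl_injective
  have : Finite κ := Finite.of_injective (Sum.inr : κ → ι ⊕ κ) Sum.inr_injective
  have := Fintype.ofFinite ι
  have := Fintype.ofFinite κ
  have hsup : H ⊔ K = ⊤ := by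
    have := Monoid.Coprod.range_lift H.subtype K.subtype
    rw [MonoidHom.range_eq_top.2 hb.2, Subgroup.range_subtype, Subgroup.range_subtype] at this
    exact this.symm
  have hκ : Nonempty κ := by
    by_contra hempty
    rw [not_nonempty_iff] at hempty
    refine hne (top_le_iff.1 (hsup ▸ sup_le le_rfl (bK.le_closure.trans ?_)))
    simp [Set.range_eq_empty]
  obtain ⟨i₀⟩ := hκ
  have hHB : H ≤ Subgroup.closure {g | g ∈
      (Finset.univ.toList.map fun i => (bH i : FreeGroup α)) ++
      (Finset.univ.erase i₀).toList.map fun i => (bK i : FreeGroup α)} := by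
    refine bH.le_closure.trans (Subgroup.closure_mono ?_)
    rintro _ ⟨i, rfl⟩
    simp
  refine ⟨_, (bK i₀ : FreeGroup α), ?_, ?_, hHB⟩
  · rw [Nat.card_eq_fintype_card, Fintype.card_sum] at hcard
    rw [List.length_append, List.length_map, List.length_map, Finset.length_toList,
      Finset.length_toList, Finset.card_univ, add_assoc,
      Finset.card_erase_add_one (Finset.mem_univ i₀), Finset.card_univ, hcard]
  · refine top_le_iff.1 (hsup ▸ sup_le (hHB.trans (Subgroup.closure_mono fun g hg => ?_))
      (bK.le_closure.trans (Subgroup.closure_mono ?_)))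
    · exact List.mem_cons_of_mem _ hg
    · rintro _ ⟨i, rfl⟩
      by_cases hi : i = i₀
      · simp [hi]
      · refine List.mem_cons_of_mem _ (List.mem_append_right _ (List.mem_map.2 ⟨i, ?_, rfl⟩))
        simp [hi]

/-- The cyclic reduction of an element of a proper free factor. -/
theorem reduceCyclically_mem_properWords {α : Type} [Fintype α] [DecidableEq α]
    {H : Subgroup (FreeGroup α)} (hH : IsFreeFactor H) (hne : H ≠ ⊤) {w : FreeGroup α}
    (hw : w ∈ H) :
    FreeGroup.reduceCyclically w.toWord ∈
      properWords α (FreeGroup.reduceCyclically w.toWord).length := by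
  obtain ⟨B, b, hlen, htop, hHB⟩ := hH.exists_generators hne
  -- The generators are conjugated along with `w`; the class of subgroups in `properWords` is closed
  -- under conjugation.
  set u := FreeGroup.mk (FreeGroup.reduceCyclically.conjugator w.toWord) with hu
  have hconj : u * FreeGroup.mk (FreeGroup.reduceCyclically w.toWord) * u⁻¹ = w := by
    rw [hu, FreeGroup.inv_mk, FreeGroup.mul_mk, FreeGroup.mul_mk,
      FreeGroup.reduceCyclically.conj_conjugator_reduceCyclically, FreeGroup.mk_toWord]
  have hmap : ∀ C : List (FreeGroup α), Subgroup.closure {g | g ∈ C.map (MulAut.conj u⁻¹)} =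
      (Subgroup.closure {g | g ∈ C}).map (MulAut.conj u⁻¹).toMonoidHom := by
    intro C
    rw [MonoidHom.map_closure]
    congr 1
    ext g
    simp
  refine ⟨rfl, FreeGroup.reduceCyclically.isCyclicallyReduced FreeGroup.isReduced_toWord,
    B.map (MulAut.conj u⁻¹), MulAut.conj u⁻¹ b, by simpa using hlen, ?_, ?_⟩
  · rw [← List.map_cons, hmap, htop, ← MonoidHom.range_eq_map, MonoidHom.range_eq_top]
    exact (MulAut.conj u⁻¹).surjective
  · rw [hmap]
    refine ⟨w, hHB hw, ?_⟩
    simp only [MulEquiv.toMonoidHom_eq_coe, MonoidHom.coe_coe, MulAut.conj_apply]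
    conv_lhs => rw [← hconj]
    group

theorem properFreeFactorWords_subset (k N : ℕ) (hN : 0 < N) :
    properFreeFactorWords k N ⊆ ⋃ j ∈ Finset.range N, if 2 * j < N then
      (fun q : List (Fin k × Bool) × List (Fin k × Bool) =>
        FreeGroup.mk (q.1 ++ q.2 ++ FreeGroup.invRev q.1)) ''
          ({u | u.length = j} ×ˢ properWords (Fin k) (N - 2 * j)) else ∅ := by
  rintro w ⟨hw, H, hH, hne, hwH⟩
  have hdecomp := FreeGroup.reduceCyclically.conj_conjugator_reduceCyclically w.toWord
  have hmem := reduceCyclically_mem_properWords hH hne hwH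
  set u := FreeGroup.reduceCyclically.conjugator w.toWord
  set c := FreeGroup.reduceCyclically w.toWord
  have hlen : 2 * u.length + c.length = N := by
    have := congrArg List.length hdecomp
    simp only [List.length_append, FreeGroup.invRev_length] at this
    unfold FreeGroup.norm at hw
    omega
  have hc : c ≠ [] := by
    intro hc
    have hw1 : w = 1 := by
      rw [← FreeGroup.mk_toWord (x := w), ← hdecomp, hc, List.append_nil, ← FreeGroup.mul_mk,
        ← FreeGroup.inv_mk, mul_inv_cancel]
    rw [hw1, FreeGroup.norm_one] at hw
    omega
  have hpos := List.length_pos_of_ne_nil hc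
  simp only [Set.mem_iUnion]
  refine ⟨u.length, Finset.mem_range.2 (by omega), ?_⟩
  rw [if_pos (by omega)]
  refine ⟨(u, c), ⟨rfl, ?_⟩, ?_⟩
  · rw [show N - 2 * u.length = c.length by omega]
    exact hmem
  · simp only
    rw [hdecomp, FreeGroup.mk_toWord]

theorem exists_ncard_properFreeFactorWords_le {k : ℕ} (hk : 3 ≤ k) {ε : ℝ} (hε : 0 < ε) :
    ∃ K : ℝ, 0 ≤ K ∧ ∀ N, 0 < N →
      ((properFreeFactorWords k N).ncard : ℝ) ≤ N * (K * (2 * k - 3 + ε) ^ N) := by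
  obtain ⟨r, rfl⟩ : ∃ r, k = r + 2 := ⟨k - 2, by omega⟩
  obtain ⟨hfin, K, hK, hle⟩ :=
    exists_ncard_properWords_le (α := Fin (r + 2)) (r := r) (by simp) hε
  have hΛ : (2 * ((r + 2 : ℕ) : ℝ) - 3 + ε) = 2 * r + 1 + ε := by push_cast; ring
  rw [hΛ]
  set Λ : ℝ := 2 * r + 1 + ε with hΛdef
  have hr : (1 : ℝ) ≤ r := by exact_mod_cast (by omega : 1 ≤ r)
  have hΛ0 : 0 < Λ := by positivity
  -- Each conjugating letter offers `2k` choices and uses up two letters of length, so this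
  -- inequality makes conjugation harmless. It needs `r ≥ 1`, that is `k ≥ 3`.
  have hsq : (2 * (r + 2) : ℝ) ≤ Λ ^ 2 := by
    rw [hΛdef]
    nlinarith
  refine ⟨K, hK, fun N hN => ?_⟩
  set T : ℕ → Set (FreeGroup (Fin (r + 2))) := fun j => if 2 * j < N then
      (fun q : List (Fin (r + 2) × Bool) × List (Fin (r + 2) × Bool) =>
        FreeGroup.mk (q.1 ++ q.2 ++ FreeGroup.invRev q.1)) ''
          ({u | u.length = j} ×ˢ properWords (Fin (r + 2)) (N - 2 * j)) else ∅ with hT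
  have hTfin : ∀ j, (T j).Finite ∧ ((T j).ncard : ℝ) ≤ K * Λ ^ N := by
    intro j
    simp only [hT]
    split_ifs with hj
    · obtain ⟨n, hn⟩ : ∃ n, N - 2 * j = n + 1 := ⟨N - 2 * j - 1, by omega⟩
      rw [hn]
      have hu : {u : List (Fin (r + 2) × Bool) | u.length = j}.Finite := List.finite_length_eq _ _
      have hucard : {u : List (Fin (r + 2) × Bool) | u.length = j}.ncard = (2 * (r + 2)) ^ j := by
        rw [← Nat.card_coe_set_eq]
        change Nat.card (List.Vector (Fin (r + 2) × Bool) j) = _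
        rw [Nat.card_eq_fintype_card, card_vector]
        simp [mul_comm]
      have hp := hu.prod (hfin n)
      refine ⟨hp.image _, ?_⟩
      have h₁ := Set.ncard_image_le (f := fun q : List (Fin (r + 2) × Bool) ×
        List (Fin (r + 2) × Bool) => FreeGroup.mk (q.1 ++ q.2 ++ FreeGroup.invRev q.1)) hp
      rw [Set.ncard_prod, hucard] at h₁
      calc _ ≤ (((2 * (r + 2)) ^ j * (properWords (Fin (r + 2)) (n + 1)).ncard : ℕ) : ℝ) := by
            exact_mod_cast h₁
        _ = (2 * (r + 2)) ^ j * ((properWords (Fin (r + 2)) (n + 1)).ncard : ℝ) := by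
            push_cast
            ring
        _ ≤ (Λ ^ 2) ^ j * (K * Λ ^ (n + 1)) := by
            gcongr
            exact hle n
        _ = K * Λ ^ N := by
            rw [← pow_mul, mul_left_comm, ← pow_add, show 2 * j + (n + 1) = N by omega]
    · simp only [Set.finite_empty, Set.ncard_empty, Nat.cast_zero, true_and]
      positivity
  have hsub := properFreeFactorWords_subset (r + 2) N hN
  have hunion : (⋃ j ∈ Finset.range N, T j).ncard ≤ ∑ j ∈ Finset.range N, (T j).ncard :=
    Finset.set_ncard_biUnion_le _ _
  have hufin : (⋃ j ∈ Finset.range N, T j).Finite :=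
    Set.Finite.biUnion (Finset.finite_toSet _) fun j _ => (hTfin j).1
  calc ((properFreeFactorWords (r + 2) N).ncard : ℝ)
      ≤ ((∑ j ∈ Finset.range N, (T j).ncard : ℕ) : ℝ) := by
        exact_mod_cast (Set.ncard_le_ncard hsub hufin).trans hunion
    _ = ∑ j ∈ Finset.range N, ((T j).ncard : ℝ) := by push_cast; rfl
    _ ≤ ∑ j ∈ Finset.range N, K * Λ ^ N := Finset.sum_le_sum fun j _ => (hTfin j).2
    _ = N * (K * Λ ^ N) := by simp

end FreeFactors

/-! ### Many non-primitive elements in one free factor. -/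

section LowerBound

/-- The value at a word of the additive character with values `f` on the generators. -/
def wordEval {β R : Type*} [AddGroup R] (f : β → R) (L : List (β × Bool)) : R :=
  (L.map fun x => cond x.2 (f x.1) (-f x.1)).sum

theorem wordEval_append {β R : Type*} [AddGroup R] (f : β → R) (L L' : List (β × Bool)) :
    wordEval f (L ++ L') = wordEval f L + wordEval f L' := by
  simp [wordEval]

theorem wordEval_eq_sum {β R : Type*} [Fintype β] [DecidableEq β] [CommRing R] (f : β → R)
    (L : List (β × Bool)) :
    wordEval f L = ∑ i, wordEval (Pi.single i (1 : R)) L * f i := by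
  induction L with
  | nil => simp [wordEval]
  | cons x L ih =>
    have hcons : ∀ g : β → R, wordEval g (x :: L) = cond x.2 (g x.1) (-g x.1) + wordEval g L :=
      fun g => by simp [wordEval]
    simp only [hcons, add_mul, Finset.sum_add_distrib, ← ih]
    congr 1
    rcases x with ⟨s, _ | _⟩ <;> simp [Pi.single_apply]

/-- A reduced word can be prolonged by six letters to change one exponent sum modulo `3`. -/
theorem exists_block {β : Type*} {i j : β} (hij : i ≠ j) {L : List (β × Bool)}
    (hL : FreeGroup.IsReduced L) (r : ZMod 3) :
    ∃ t : List (β × Bool), t.length = 6 ∧ FreeGroup.IsReduced (L ++ t) ∧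
      ∀ f : β → ZMod 3, wordEval f t = r * f i := by
  -- Modulo 3, the sums `2 - 2`, `2 + 2` and `-2 - 2` cover all residues, so one block length serves
  -- every `r`.
  obtain ⟨σ, τ, hστ⟩ : ∃ σ τ : Bool, ∀ a : ZMod 3,
      cond σ a (-a) + cond σ a (-a) + (cond τ a (-a) + cond τ a (-a)) = r * a := by
    fin_cases r
    · exact ⟨true, false, by decide⟩
    · exact ⟨true, true, by decide⟩
    · exact ⟨false, false, by decide⟩
  -- The block starts with `j` if `L` ends in `i` or its inverse, and with `i` otherwise, so nothing
  -- cancels at the junction.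
  by_cases hlast : ∃ x ∈ L.getLast?, x.1 = i
  · refine ⟨[(j, true), (i, σ), (i, σ), (j, false), (i, τ), (i, τ)], rfl, ?_, fun f => ?_⟩
    · refine List.isChain_append.2 ⟨hL, by simp [hij, hij.symm], ?_⟩
      obtain ⟨x, hx, hxi⟩ := hlast
      intro x' hx' y hy
      obtain rfl := Option.mem_unique hx hx'
      simp only [List.head?_cons, Option.mem_def, Option.some.injEq] at hy
      subst hy
      exact fun h => absurd (hxi.symm.trans h) hij
    · rw [← hστ (f i)]
      simp only [wordEval, List.map_cons, List.map_nil, List.sum_cons, List.sum_nil, cond_true,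
        cond_false]
      ring
  · refine ⟨[(i, σ), (i, σ), (j, true), (i, τ), (i, τ), (j, false)], rfl, ?_, fun f => ?_⟩
    · refine List.isChain_append.2 ⟨hL, by simp [hij, hij.symm], ?_⟩
      intro x hx y hy
      simp only [List.head?_cons, Option.mem_def, Option.some.injEq] at hy
      subst hy
      exact fun h => absurd ⟨x, hx, h⟩ hlast
    · rw [← hστ (f i)]
      simp only [wordEval, List.map_cons, List.map_nil, List.sum_cons, List.sum_nil, cond_true,
        cond_false]
      ring

theorem exists_tail {β : Type*} [Nontrivial β] (c : β → ZMod 3) (l : List β)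
    {L : List (β × Bool)} (hL : FreeGroup.IsReduced L) :
    ∃ t : List (β × Bool), t.length = 6 * l.length ∧ FreeGroup.IsReduced (L ++ t) ∧
      ∀ f : β → ZMod 3, wordEval f t = (l.map fun i => c i * f i).sum := by
  induction l generalizing L with
  | nil => exact ⟨[], rfl, by simpa using hL, fun f => by simp [wordEval]⟩
  | cons i l ih =>
    obtain ⟨j, hj⟩ := exists_ne i
    obtain ⟨t, ht, hred, hev⟩ := exists_block hj.symm hL (c i)
    obtain ⟨t', ht', hred', hev'⟩ := ih hred
    refine ⟨t ++ t', ?_, by simpa using hred', fun f => ?_⟩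
    · rw [List.length_append, ht, ht', List.length_cons]
      ring
    · rw [wordEval_append, hev, hev']
      simp

/-- A reduced word can be prolonged by a fixed number of letters so that all its exponent sums
vanish modulo `3`. -/
theorem exists_tail_wordEval_eq_zero {β : Type*} [Nontrivial β] [Fintype β]
    {L : List (β × Bool)} (hL : FreeGroup.IsReduced L) :
    ∃ t : List (β × Bool), t.length = 6 * Fintype.card β ∧ FreeGroup.IsReduced (L ++ t) ∧
      ∀ f : β → ZMod 3, wordEval f (L ++ t) = 0 := by
  classical
  obtain ⟨t, ht, hred, hev⟩ :=
    exists_tail (fun i => -wordEval (Pi.single i (1 : ZMod 3)) L) Finset.univ.toList hL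
  refine ⟨t, by simpa using ht, hred, fun f => ?_⟩
  rw [wordEval_append, hev, wordEval_eq_sum f L, Finset.sum_map_toList]
  simp

theorem lift_mk_eq_wordEval {β R : Type*} [AddGroup R] (f : β → R) (L : List (β × Bool)) :
    FreeGroup.lift (fun i => Multiplicative.ofAdd (f i)) (FreeGroup.mk L) =
      Multiplicative.ofAdd (wordEval f L) := by
  rw [FreeGroup.lift_mk, wordEval]
  induction L with
  | nil => rfl
  | cons x L ih =>
    rw [List.map_cons, List.prod_cons, ih, List.map_cons, List.sum_cons, ofAdd_add]
    rcases x with ⟨s, _ | _⟩ <;> rfl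

/-- The character sending every element of a basis to `1` in `ZMod 3` would have to vanish on this
element. -/
theorem not_isPrimitive_of_wordEval {β γ : Type} (g : β → γ) {L : List (β × Bool)}
    (hL : ∀ f : β → ZMod 3, wordEval f L = 0) :
    ¬ IsPrimitive (FreeGroup.map g (FreeGroup.mk L)) := by
  classical
  rintro ⟨ι, b, i, hi⟩
  set χ : FreeGroup γ →* Multiplicative (ZMod 3) := b.lift fun _ => Multiplicative.ofAdd 1 with hχ
  have h₁ : χ (FreeGroup.map g (FreeGroup.mk L)) = Multiplicative.ofAdd 1 := by
    rw [← hi, hχ]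
    simp [FreeGroupBasis.lift]
  have h₂ : χ.comp (FreeGroup.map g) =
      FreeGroup.lift fun j =>
        Multiplicative.ofAdd (Multiplicative.toAdd (χ (FreeGroup.of (g j)))) := by
    ext j
    simp
  have h₃ := DFunLike.congr_fun h₂ (FreeGroup.mk L)
  rw [lift_mk_eq_wordEval, hL, MonoidHom.comp_apply, h₁] at h₃
  exact absurd h₃ (by decide)

/-- The subgroup generated by all generators but the last one is a free factor. -/
theorem isFreeFactor_range_map_castSucc (n : ℕ) :
    IsFreeFactor (FreeGroup.map (Fin.castSucc : Fin n → Fin (n + 1))).range := by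
  let φ := FreeGroup.map (Fin.castSucc : Fin n → Fin (n + 1))
  let θ := FreeGroup.map (fun _ : Unit => Fin.last n)
  let ψ : FreeGroup (Fin (n + 1)) →* Monoid.Coprod φ.range θ.range :=
    FreeGroup.lift (Fin.lastCases (motive := fun _ => Monoid.Coprod φ.range θ.range)
      (Monoid.Coprod.inr (θ.rangeRestrict (FreeGroup.of ())))
      fun i => Monoid.Coprod.inl (φ.rangeRestrict (FreeGroup.of i)))
  refine ⟨θ.range, Function.bijective_iff_has_inverse.2 ⟨ψ, ?_, ?_⟩⟩
  · intro x
    refine DFunLike.congr_fun (f := ψ.comp (Monoid.Coprod.lift φ.range.subtype θ.range.subtype))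
      (g := MonoidHom.id _) (Monoid.Coprod.hom_ext ?_ ?_) x
    · refine (MonoidHom.cancel_right φ.rangeRestrict_surjective).1 ?_
      ext i
      simp [φ, ψ]
    · refine (MonoidHom.cancel_right θ.rangeRestrict_surjective).1 ?_
      ext i
      simp [θ, ψ]
  · intro x
    refine DFunLike.congr_fun (f := (Monoid.Coprod.lift φ.range.subtype θ.range.subtype).comp ψ)
      (g := MonoidHom.id _) ?_ x
    ext i
    refine Fin.lastCases ?_ (fun i => ?_) i
    · simp [θ, ψ]
    · simp [φ, ψ]

theorem range_map_castSucc_ne_top (n : ℕ) :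
    (FreeGroup.map (Fin.castSucc : Fin n → Fin (n + 1))).range ≠ ⊤ := by
  intro htop
  let χ : FreeGroup (Fin (n + 1)) →* Multiplicative ℤ :=
    FreeGroup.lift (Fin.lastCases (motive := fun _ => Multiplicative ℤ) (Multiplicative.ofAdd 1)
      fun _ => 1)
  obtain ⟨g, hg⟩ := MonoidHom.range_eq_top.1 htop (FreeGroup.of (Fin.last n))
  have h₁ : χ.comp (FreeGroup.map (Fin.castSucc : Fin n → Fin (n + 1))) = 1 := by
    ext i
    simp [χ]
  have h₂ := DFunLike.congr_fun h₁ g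
  rw [MonoidHom.comp_apply, hg] at h₂
  simp [χ] at h₂

/-- There are at least `(2 |β| - 1) ^ M` reduced words of length `M`. -/
theorem exists_injective_reduced {β : Type*} [Fintype β] [Nonempty β] :
    ∃ g : List (Fin (2 * Fintype.card β - 1)) → List (β × Bool), Function.Injective g ∧
      ∀ s, (g s).length = s.length ∧ FreeGroup.IsReduced (g s) := by
  classical
  have hemb : ∀ a : β × Bool, Nonempty (Fin (2 * Fintype.card β - 1) ↪
      {b : β × Bool // b ≠ (a.1, !a.2)}) := by
    intro a
    refine Function.Embedding.nonempty_of_card_le ?_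
    rw [Fintype.card_subtype_compl, Fintype.card_subtype_eq]
    simp [mul_comm]
  obtain ⟨a₀⟩ : Nonempty (β × Bool) := inferInstance
  let E : ∀ a : β × Bool, Fin (2 * Fintype.card β - 1) ↪ {b : β × Bool // b ≠ (a.1, !a.2)} :=
    fun a => (hemb a).some
  let g : List (Fin (2 * Fintype.card β - 1)) → List (β × Bool) :=
    List.foldr (fun c L => (E (L.head?.getD a₀) c).1 :: L) []
  have hcons : ∀ c s, g (c :: s) = (E ((g s).head?.getD a₀) c).1 :: g s := fun _ _ => rfl
  refine ⟨g, ?_, ?_⟩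
  · intro s s' h
    induction s generalizing s' with
    | nil =>
      cases s' with
      | nil => rfl
      | cons c' s' => simp [hcons, g] at h
    | cons c s ih =>
      cases s' with
      | nil => simp [hcons, g] at h
      | cons c' s' =>
        rw [hcons, hcons, List.cons.injEq] at h
        obtain rfl := ih h.2
        rw [(E _).injective (Subtype.ext h.1)]
  · intro s
    induction s with
    | nil => exact ⟨rfl, FreeGroup.IsReduced.nil⟩
    | cons c s ih =>
      rw [hcons]
      refine ⟨by simp [ih.1], List.isChain_cons.2 ⟨fun y hy hfst => ?_, ih.2⟩⟩
      have hne := (E ((g s).head?.getD a₀) c).2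
      rw [Option.mem_def] at hy
      rw [hy] at hne hfst ⊢
      by_contra hsnd
      exact hne (Prod.ext hfst (Bool.eq_not_of_ne hsnd))

/-- The number of non-primitive elements of length `M + 6 n` in proper free factors of the free
group of rank `n + 1` is at least `(2 n - 1) ^ M`. -/
theorem pow_le_ncard_sdiff {n : ℕ} (hn : 2 ≤ n) (M : ℕ) :
    (2 * n - 1) ^ M ≤ (properFreeFactorWords (n + 1) (M + 6 * n) \
      primitiveWords (n + 1) (M + 6 * n)).ncard := by
  have : Nontrivial (Fin n) := Fin.nontrivial_iff_two_le.2 hn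
  obtain ⟨g, hg, hgs⟩ := exists_injective_reduced (β := Fin n)
  choose t ht hred hev using fun s => exists_tail_wordEval_eq_zero (hgs s).2
  simp only [Fintype.card_fin] at ht
  have hinj : Function.Injective fun x : Fin n × Bool => (x.1.castSucc, x.2) := by
    rintro ⟨a, b⟩ ⟨a', b'⟩ h
    simpa using h
  have hmapred : ∀ s, FreeGroup.IsReduced
      ((g s ++ t s).map fun x : Fin n × Bool => (x.1.castSucc, x.2)) := fun s => by
    refine List.isChain_map _ |>.2 ((hred s).imp fun a b h => ?_)
    simpa using h
  have hword : ∀ s, (FreeGroup.map Fin.castSucc (FreeGroup.mk (g s ++ t s))).toWord =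
      (g s ++ t s).map fun x : Fin n × Bool => (x.1.castSucc, x.2) := fun s => by
    rw [FreeGroup.map.mk, FreeGroup.toWord_mk, (hmapred s).reduce_eq]
  have hcard : {s : List (Fin (2 * Fintype.card (Fin n) - 1)) | s.length = M}.ncard =
      (2 * n - 1) ^ M := by
    rw [← Nat.card_coe_set_eq]
    change Nat.card (List.Vector (Fin (2 * Fintype.card (Fin n) - 1)) M) = _
    rw [Nat.card_eq_fintype_card, card_vector]
    simp
  rw [← hcard]
  refine Set.ncard_le_ncard_of_injOn
    (fun s => FreeGroup.map Fin.castSucc (FreeGroup.mk (g s ++ t s))) ?_ ?_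
    ((properFreeFactorWords_finite _ _).subset Set.sdiff_subset)
  · intro s hs
    refine ⟨⟨?_, _, isFreeFactor_range_map_castSucc n, range_map_castSucc_ne_top n, _, rfl⟩,
      fun hp => not_isPrimitive_of_wordEval _ (hev s) hp.2⟩
    rw [FreeGroup.norm, hword, List.length_map, List.length_append, (hgs s).1, ht, hs]
  · intro s hs s' hs' h
    have h₁ := congrArg FreeGroup.toWord h
    simp only [hword] at h₁
    have h₂ := List.map_injective_iff.2 hinj h₁
    exact hg (List.append_inj_left h₂ (by rw [(hgs s).1, (hgs s').1, hs, hs']))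

end LowerBound

/-! ### Extraction of the `N`-th root. -/

section Limit

theorem tendsto_rpow_one_div {a : ℕ → ℝ} {l c : ℝ} (hl : 0 < l) (hc : 0 < c)
    (hlow : ∀ᶠ N in Filter.atTop, c * l ^ N ≤ a N)
    (hup : ∀ ε > 0, ∃ K : ℝ, 0 ≤ K ∧ ∀ N : ℕ, 0 < N → a N ≤ N * (K * (l + ε) ^ N)) :
    Filter.Tendsto (fun N : ℕ => a N ^ (1 / (N : ℝ))) Filter.atTop (nhds l) := by
  have hone : Filter.Tendsto (fun N : ℕ => 1 / (N : ℝ)) Filter.atTop (nhds 0) :=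
    tendsto_one_div_atTop_nhds_zero_nat
  have hconst : ∀ C : ℝ, 0 < C →
      Filter.Tendsto (fun N : ℕ => C ^ (1 / (N : ℝ))) Filter.atTop (nhds 1) := by
    intro C hC
    have := (Real.continuous_const_rpow hC.ne').tendsto 0 |>.comp hone
    simpa [Function.comp_def] using this
  have hN : Filter.Tendsto (fun N : ℕ => (N : ℝ) ^ (1 / (N : ℝ))) Filter.atTop (nhds 1) :=
    tendsto_rpow_div.comp tendsto_natCast_atTop_atTop
  have hroot : ∀ (x : ℝ) (N : ℕ), 0 ≤ x → 0 < N → (x ^ N) ^ (1 / (N : ℝ)) = x := by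
    intro x N hx hN
    rw [one_div, Real.pow_rpow_inv_natCast hx hN.ne']
  refine tendsto_order.2 ⟨fun b hb => ?_, fun b hb => ?_⟩
  · have h₁ : Filter.Tendsto (fun N : ℕ => c ^ (1 / (N : ℝ)) * l) Filter.atTop (nhds (1 * l)) :=
      (hconst c hc).mul_const l
    rw [one_mul] at h₁
    filter_upwards [h₁.eventually_const_lt hb, hlow, Filter.eventually_gt_atTop 0]
      with N hbN hlowN hNpos
    refine hbN.trans_le ?_
    calc c ^ (1 / (N : ℝ)) * l = (c * l ^ N) ^ (1 / (N : ℝ)) := by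
          rw [Real.mul_rpow hc.le (by positivity), hroot l N hl.le hNpos]
      _ ≤ a N ^ (1 / (N : ℝ)) := Real.rpow_le_rpow (by positivity) hlowN (by positivity)
  · obtain ⟨K, hK, hle⟩ := hup ((b - l) / 2) (by linarith)
    have hmid : l + (b - l) / 2 < b := by linarith
    have hmid0 : 0 < l + (b - l) / 2 := by linarith
    have h₁ : Filter.Tendsto (fun N : ℕ => (N : ℝ) ^ (1 / (N : ℝ)) *
        ((K + 1) ^ (1 / (N : ℝ)) * (l + (b - l) / 2))) Filter.atTop
          (nhds (1 * (1 * (l + (b - l) / 2)))) :=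
      hN.mul ((hconst (K + 1) (by linarith)).mul_const _)
    rw [one_mul, one_mul] at h₁
    filter_upwards [h₁.eventually_lt_const hmid, hlow, Filter.eventually_gt_atTop 0]
      with N hbN hlowN hNpos
    refine lt_of_le_of_lt ?_ hbN
    have ha : 0 ≤ a N := le_trans (by positivity) hlowN
    -- Using `K + 1` keeps the constant positive, so that its `N`-th root tends to `1`.
    calc a N ^ (1 / (N : ℝ)) ≤
        (N * ((K + 1) * (l + (b - l) / 2) ^ N)) ^ (1 / (N : ℝ)) := by
          refine Real.rpow_le_rpow ha ((hle N hNpos).trans ?_) (by positivity)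
          gcongr
          linarith
      _ = _ := by
          rw [Real.mul_rpow (by positivity) (by positivity),
            Real.mul_rpow (by positivity) (by positivity), hroot _ N hmid0.le hNpos]

end Limit

theorem corollary1p4 (k : ℕ) (hk : 3 ≤ k) :
    Filter.Tendsto
        (fun N : ℕ => ((properFreeFactorWords k N).ncard : ℝ) ^ (1 / (N : ℝ)))
        Filter.atTop (nhds (2 * (k : ℝ) - 3)) ∧
      Filter.Tendsto
        (fun N : ℕ => ((properFreeFactorWords k N \ primitiveWords k N).ncard : ℝ) ^ (1 / (N : ℝ)))
        Filter.atTop (nhds (2 * (k : ℝ) - 3)) := by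
  have hle : ∀ N, ((properFreeFactorWords k N \ primitiveWords k N).ncard : ℝ) ≤
      (properFreeFactorWords k N).ncard := fun N => by
    exact_mod_cast Set.ncard_le_ncard Set.sdiff_subset (properFreeFactorWords_finite k N)
  have hk' : (3 : ℝ) ≤ k := by exact_mod_cast hk
  have hl : (0 : ℝ) < 2 * k - 3 := by linarith
  -- This constant pays for the `6 (k - 1)` letters of the tail that kills the exponent sums.
  have hc : 0 < ((2 * (k : ℝ) - 3) ^ (6 * (k - 1)))⁻¹ := by positivity
  have hlow : ∀ N, 6 * (k - 1) ≤ N → ((2 * (k : ℝ) - 3) ^ (6 * (k - 1)))⁻¹ * (2 * k - 3) ^ N ≤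
      ((properFreeFactorWords k N \ primitiveWords k N).ncard : ℝ) := by
    intro N hN
    obtain ⟨M, rfl⟩ := Nat.exists_eq_add_of_le' hN
    rw [pow_add, mul_comm _ ((2 * (k : ℝ) - 3) ^ (6 * (k - 1))),
      inv_mul_cancel_left₀ (by positivity)]
    obtain ⟨n, rfl⟩ : ∃ n, k = n + 1 := ⟨k - 1, by omega⟩
    have h := pow_le_ncard_sdiff (n := n) (by omega) M
    have hcast : (2 * ((n + 1 : ℕ) : ℝ) - 3) = ((2 * n - 1 : ℕ) : ℝ) := by
      rw [Nat.cast_sub (by omega)]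
      push_cast
      ring
    rw [hcast, Nat.add_sub_cancel]
    exact_mod_cast h
  have hev := Filter.eventually_ge_atTop (6 * (k - 1))
  refine ⟨tendsto_rpow_one_div hl hc (hev.mono fun N hN => (hlow N hN).trans (hle N))
    fun ε hε => exists_ncard_properFreeFactorWords_le hk hε,
    tendsto_rpow_one_div hl hc (hev.mono hlow) fun ε hε => ?_⟩
  obtain ⟨K, hK, h⟩ := exists_ncard_properFreeFactorWords_le hk hε
  exact ⟨K, hK, fun N hN => (hle N).trans (h N hN)⟩
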